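/- **Trees and games.** Let $\mathbb T$ be the set of finite words over $\{1,2,\dots\}$, with root $r$ the empty word; the children of $x$ are the words $xk$, $f(x)$ is the father of $x\ne r$, $|x|$ is the length of $x$, $B_{rx}$ is the set of prefixes of $x$ (including $r$ and $x$), and $\mathbb T_x$ is the set of words with prefix $x$. Two different words with the same father are brothers. For finite $\mathbf x\subset\mathbb T$ set $B_{\mathbf x}=\bigcup_{x\in\mathbf x}B_{rx}$, and let $\mathbb D_{\mathbf x}$ be the set of brothers of elements of $B_{\mathbf x}$ that are not in $B_{\mathbf x}$. Let $\mathcal S_f$ be the set of finite prefix-closed $T\subset\mathbb T$ containing $r$, and let $L_T$ be the set of leaves of $T\in\mathcal S_f$. For $T\in\mathcal S_f$ let $K^T_x$ consist of $r$ and of the children in $T$ of the strict prefixes of $x$. Let $\mathcal T$ be a random element of $\mathcal S_f$, with leaves $\mathcal L=L_{\mathcal T}$ and random outcomes $R(x)\in\{0,1\}$, $x\in\mathcal L$. Write $\mathcal C_x,\mathcal H_x$ for the sets of children and brothers of $x$ in $\mathcal T$, $\mathcal K_x=K^{\mathcal T}_x$, $\mathcal T_x=\mathcal T\cap\mathbb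 T_x$ and $\mathcal D_{\mathbf x}=\mathcal T\cap\mathbb D_{\mathbf x}$. Player $J_1$ moves at the non-terminal nodes $x$ with $|x|$ even ($t(x)=1$) and player $J_0$ at those with $|x|$ odd ($t(x)=0$). For $x\in\mathcal T$ let $R(x)=1$ if $J_1$ has a strategy which, starting from $x$, always leads to a leaf with outcome $1$, and $R(x)=0$ otherwise. A *uniformly random match* from $x\in\mathcal T$ moves from the current node to a uniformly chosen child of it in $\mathcal T$, with fresh randomness, until it reaches a leaf (the resulting leaf). **Assumption.** For $T\in\mathcal S_f$ put $A_T=\{T\subset\mathcal T,\ \mathcal D_{L_T}=\emptyset\}$. Whenever $\Pr(A_T)>0$, the family $\big(\mathcal T_x,(R(y))_{y\in\mathcal L\cap\mathcal T_x}\big)_{x\in L_T}$ is independent conditionally on $A_T$. For such $T$ and $z\in L_T$ set $m(T,z)=\Pr(R(z)=1\mid A_T)$ and $$s(T,z)=\mathbb E\big[\big(\Pr(R(z)=1\mid\mathcal G\vee\sigma(A_T))-m(T,z)\big)^2\,\big|\,A_T\big],$$ where $\mathcal G=\sigma(y,\mathcal K_y\cap\mathbb T_z,R(y))$ and $y$ is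 the resulting leaf of a uniformly random match from $z$. **Simulated matches.** An admissible algorithm produces leaves $x_1,x_2,\dots$, with $\mathbf x_k=\{x_1,\dots,x_k\}$, as follows. The leaf $x_1$ results from a uniformly random match from $r$. After $k$ matches it selects $z_k=F(\mathbf x_k,\mathcal D_{\mathbf x_k},(R(x))_{x\in\mathbf x_k},X_k)\in\mathcal D_{\mathbf x_k}\cup\mathbf x_k$, where $F$ is deterministic and measurable and $X_k$ is uniform on $[0,1]$ and independent of the game and of the past of the algorithm. If $z_k\in\mathbf x_k$ then $x_{k+1}=z_k$; if $z_k\in\mathcal D_{\mathbf x_k}$ then $x_{k+1}$ results from a uniformly random match from $z_k$. Fix $n\ge1$ and assume that $n$ matches have been simulated in this way. Let $$\mathcal F_n=\sigma\big(\mathbf x_n,\mathcal D_{\mathbf x_n},(R(x))_{x\in\mathbf x_n}\big),\qquad R_n(x)=\Pr(R(x)=1\mid\mathcal F_n)\quad(x\in B_{\mathbf x_n}\cup\mathcal D_{\mathbf x_n}).$$ For $x\in(B_{\mathbf x_n}\cup\mathcal D_{\mathbf x_n})\setminus\{r\}$ let $U_n(x)=\prod_{y\in\mathcal H_x}R_n(y)$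 if $t(f(x))=0$ and $U_n(x)=\prod_{y\in\mathcal H_x}(1-R_n(y))$ if $t(f(x))=1$. Define $Z_n$ on $B_{\mathbf x_n}\cup\mathcal D_{\mathbf x_n}$ by backward induction: $Z_n(x)=0$ if $x\in\mathbf x_n$; $Z_n(x)=s(\mathcal K_x,x)$ if $x\in\mathcal D_{\mathbf x_n}$; and $Z_n(x)=\max\{U_n(y)^2Z_n(y):y\in\mathcal C_x\}$ if $x\in B_{\mathbf x_n}\setminus\mathbf x_n$. For $z\in\mathcal D_{\mathbf x_n}$ let $y_z$ be the resulting leaf of a uniformly random match from $z$, and put $\mathbf x^z_{n+1}=\mathbf x_n\cup\{y_z\}$, $\mathcal F^z_{n+1}=\sigma\big(\mathbf x^z_{n+1},\mathcal D_{\mathbf x^z_{n+1}},(R(x))_{x\in\mathbf x^z_{n+1}}\big)$ and $R^z_{n+1}(r)=\Pr(R(r)=1\mid\mathcal F^z_{n+1})$. **Theorem.** Under the above assumption, define $z_*\in\mathcal D_{\mathbf x_n}\cup\mathbf x_n$ by starting at $r$ and moving repeatedly from the current node $x$ to a child $y\in\mathcal C_x$ which maximises $U_n(y)^2Z_n(y)$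 (ties being broken in any way), until a node of $\mathcal D_{\mathbf x_n}\cup\mathbf x_n$ is reached. Almost surely on the event $\{R_n(r)\notin\{0,1\}\}$, this procedure stops, $z_*\in\mathcal D_{\mathbf x_n}$, and $$\mathbb E\big[(R^{z_*}_{n+1}(r)-R(r))^2\,\big|\,\mathcal F_n\big]=\min_{z\in\mathcal D_{\mathbf x_n}}\mathbb E\big[(R^{z}_{n+1}(r)-R(r))^2\,\big|\,\mathcal F_n\big],$$ where the left-hand side is the value at $z=z_*$ of the function of $z$ minimised on the right. -/

import Mathlib

namespace MCTS

open MeasureTheory ProbabilityTheory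
open scoped Classical

noncomputable section

/-! ## Words and finite trees -/

/-- Nodes of the complete ordered tree of infinite degree: finite words over the positive integers.
The root is the empty word, and `x ++ [k]` is the `k`-th child of `x`. -/
abbrev Word := List ℕ+

instance : MeasurableSpace Word := ⊤
instance : MeasurableSpace (Finset Word) := ⊤

/-- `y` is a child of `x`. -/
def IsChild (x y : Word) : Prop := ∃ k : ℕ+, y = x ++ [k]

/-- The father of a word (used only for words different from the root). -/
def father (x : Word) : Word := x.dropLast

/-- `x` and `y` are different and have the same father. -/
def IsBrother (x y : Word) : Prop := x ≠ y ∧ ∃ v, IsChild v x ∧ IsChild v y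

/-- The branch from the root to `x`: all the prefixes of `x`, including the root and `x`. -/
def branch (x : Word) : Finset Word := x.inits.toFinset

/-- The union of the branches from the root to the elements of `xs`. -/
def branches (xs : Finset Word) : Finset Word := xs.biUnion branch

/-- The brothers, in the complete tree, of the elements of `branches xs`,
which are not themselves in `branches xs`. -/
def outerBoundary (xs : Finset Word) : Set Word :=
  {y | (∃ x ∈ branches xs, IsBrother x y) ∧ y ∉ branches xs}

/-- Finite trees containing the root. -/
structure IsTree (T : Finset Word) : Prop where
  root_mem : [] ∈ T
  branch_subset : ∀ x ∈ T, branch x ⊆ T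

/-- The children of `x` in `T`. -/
def children (T : Finset Word) (x : Word) : Finset Word := T.filter (fun y => IsChild x y)

/-- The brothers of `x` in `T`. -/
def brothers (T : Finset Word) (x : Word) : Finset Word := T.filter (fun y => IsBrother x y)

/-- The progeny of `x` in `T`, including `x`. -/
def progeny (T : Finset Word) (x : Word) : Finset Word := T.filter (fun y => x <+: y)

/-- The root together with all the children, in `T`, of the strict ancestors of `x`; that is, `x`,
its brothers, its father and uncles, its grandfather and granduncles, etc. -/
def kin (T : Finset Word) (x : Word) : Finset Word :=
  T.filter (fun u => u = [] ∨ ∃ y ∈ branch x, y ≠ x ∧ IsChild y u)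

/-- The leaves of `T`. -/
def leaves (T : Finset Word) : Finset Word := T.filter (fun x => progeny T x = {x})

/-- The brothers, in `T`, of the elements of `branches xs`, which are not in `branches xs`. -/
def boundary (T xs : Finset Word) : Finset Word := T.filter (fun y => y ∈ outerBoundary xs)

theorem length_lt_of_mem_children {T : Finset Word} {x y : Word} (h : y ∈ children T x) :
    T.sup List.length + 1 - y.length < T.sup List.length + 1 - x.length := by
  obtain ⟨hy, k, rfl⟩ := Finset.mem_filter.1 h
  have := Finset.le_sup (f := List.length) hy
  simp only [List.length_append, List.length_cons, List.length_nil] at this ⊢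
  omega

/-! ## Games and minimax values -/

/-- A game: a finite tree, together with an outcome in `{0, 1}` at each of its leaves. The outcomes
are encoded by the set `wins` of the leaves with outcome `1` (victories of the first player). -/
@[ext]
structure Game where
  tree : Finset Word
  isTree : IsTree tree
  wins : Finset Word
  wins_subset : wins ⊆ leaves tree

instance : MeasurableSpace Game := ⊤

instance : Countable Game :=
  Function.Injective.countable (f := fun g : Game => (g.tree, g.wins)) (by
    intro g h hgh
    simp only [Prod.mk.injEq] at hgh
    exact Game.ext hgh.1 hgh.2)

/-- It is the turn of the first player (who starts at the root) at the nodes of even depth. -/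
def FirstPlays (x : Word) : Prop := Even x.length

/-- The first player has a winning strategy when the game is started at `x`: a legal choice `σ` of a
move at each of his positions, such that all the leaves which can be reached from `x` when he plays
according to `σ` have outcome `1`. -/
def Game.FirstWinsFrom (g : Game) (x : Word) : Prop :=
  ∃ σ : Word → Word,
    (∀ u ∈ g.tree, u ∉ leaves g.tree → FirstPlays u → σ u ∈ children g.tree u) ∧
    ∀ y ∈ leaves g.tree, x <+: y →
      (∀ u ∈ branch y, x <+: u → u ≠ y → FirstPlays u → σ u ∈ branch y) → y ∈ g.wins

/-- The minimax value `R(x)` of the node `x`. -/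
def Game.value (g : Game) (x : Word) : ℝ := if g.FirstWinsFrom x then 1 else 0

/-- The pair formed by the tree of the descendants of `x` and by the outcomes at the leaves of the
game that are descendants of `x`. -/
def Game.subgame (g : Game) (x : Word) : Finset Word × Finset Word :=
  (progeny g.tree x, g.wins.filter (fun y => x <+: y))

/-- The law of the resulting leaf of a uniformly random match in `T` starting from `x`: as long as
the current node has children, move to a uniformly chosen one. -/
def uniformMatch (T : Finset Word) (x : Word) : PMF Word :=
  if h : (children T x).attach.Nonempty then
    (PMF.uniformOfFinset (children T x).attach h).bind (fun y => uniformMatch T y.1)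
  else PMF.pure x
termination_by T.sup List.length + 1 - x.length
decreasing_by exact length_lt_of_mem_children y.2

/-! ## The random model -/

/-- The event on which `T` is contained in the tree of the game and contains all the brothers
of its elements. -/
def exploredEvent (T : Finset Word) : Set Game :=
  {g | T ⊆ g.tree ∧ boundary g.tree (leaves T) = ∅}

/-- The branching property of the law `μ` of the random game: for each finite tree `T` such that
`exploredEvent T` has positive probability, conditionally on this event, the subgames issued from
the leaves of `T` are independent. -/
def BranchingProperty (μ : Measure Game) : Prop :=
  ∀ T : Finset Word, IsTree T → μ (exploredEvent T) ≠ 0 →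
    iIndepFun (fun (x : {x // x ∈ leaves T}) (g : Game) => g.subgame x.1) (μ[|exploredEvent T])

/-- `m(T, z)`: the probability that `R(z) = 1` knowing `exploredEvent T`. -/
def meanValue (μ : Measure Game) (T : Finset Word) (z : Word) : ℝ :=
  (μ[|exploredEvent T]).real {g | g.value z = 1}

/-- Knowing the game, the law of the resulting leaf of a uniformly random match started at `z`. -/
def matchKernel (z : Word) : Kernel Game Word where
  toFun g := (uniformMatch g.tree z).toMeasure
  measurable' := measurable_from_top

instance (z : Word) : IsMarkovKernel (matchKernel z) :=
  ⟨fun g => inferInstanceAs (IsProbabilityMeasure (uniformMatch g.tree z).toMeasure)⟩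

/-- The information provided by a match in `g` started at `z` with resulting leaf `y`: the leaf
itself, the part of `kin g.tree y` below `z`, and the outcome at `y`. -/
def matchInfo (z : Word) (p : Game × Word) : Word × Finset Word × Bool :=
  (p.2, (kin p.1.tree p.2).filter (fun u => z <+: u), decide (p.2 ∈ p.1.wins))

/-- `s(T, z)`: knowing `exploredEvent T`, the mean square increment of the conditional probability
that `R(z) = 1` due to the information provided by a uniformly random match started at `z`. -/
def meanInformation (μ : Measure Game) (T : Finset Word) (z : Word) : ℝ :=
  let Q : Measure (Game × Word) := μ ⊗ₘ matchKernel z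
  let A : Set (Game × Word) := Prod.fst ⁻¹' exploredEvent T
  let 𝓖 : MeasurableSpace (Game × Word) :=
    MeasurableSpace.comap (matchInfo z) inferInstance ⊔ MeasurableSpace.generateFrom {A}
  ∫ p, ((Q[({p | p.1.value z = 1} : Set (Game × Word)).indicator (fun _ => (1 : ℝ)) | 𝓖]) p
    - meanValue μ T z) ^ 2 ∂(Q[|A])

/-! ## Admissible algorithms -/

/-- What is known after some matches: the set of visited leaves, its boundary in the tree of the
game, and the outcomes at the visited leaves (encoded by the set of those with outcome `1`). -/
structure Observation where
  visited : Finset Word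
  bdry : Finset Word
  wins : Finset Word

instance : MeasurableSpace Observation := ⊤

/-- The knowledge of the game `g` when the visited leaves are `xs`. -/
def observe (g : Game) (xs : Finset Word) : Observation :=
  ⟨xs, boundary g.tree xs, xs ∩ g.wins⟩

/-- The visited leaves are the leaves of some finite tree, and the boundary is a set of brothers
of the explored nodes. -/
def Observation.IsPossible (o : Observation) : Prop :=
  (∃ B, IsTree B ∧ o.visited = leaves B) ∧ (↑o.bdry ⊆ outerBoundary o.visited) ∧
    o.wins ⊆ o.visited

/-- The (randomized, through a number in `[0, 1]`) selection rule of an admissible algorithm. -/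
structure SelectionRule where
  select : Observation → unitInterval → Word
  measurable_select : ∀ o, Measurable (select o)
  select_mem : ∀ o : Observation, o.IsPossible → ∀ u, select o u ∈ o.visited ∪ o.bdry

variable {Ω : Type*} [MeasurableSpace Ω]

/-- The set of the leaves resulting from the `n` first matches (numbered from `1`). -/
def visited (x : ℕ → Ω → Word) (n : ℕ) (ω : Ω) : Finset Word :=
  (Finset.Icc 1 n).image (fun i => x i ω)

/-- The random boundary associated with a random set of visited leaves. -/
def bdry (game : Ω → Game) (v : Ω → Finset Word) (ω : Ω) : Finset Word :=
  boundary (game ω).tree (v ω)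

/-- The whole past just after the `k`-th match: the game, the random numbers used to select the
starting points of the matches `2, …, k`, and the resulting leaves of the matches `1, …, k`. -/
abbrev past (game : Ω → Game) (X : ℕ → Ω → unitInterval) (x : ℕ → Ω → Word) (k : ℕ) :
    MeasurableSpace Ω :=
  MeasurableSpace.comap game ⊤ ⊔
    (⨆ i ∈ Set.Ico 1 k, MeasurableSpace.comap (X i) inferInstance) ⊔
    (⨆ i ∈ Set.Icc 1 k, MeasurableSpace.comap (x i) ⊤)

/-- On the event `E`, the random leaf `y` is the result of a uniformly random match started at the
random node `z`: its conditional law knowing `𝓗` is the law of a uniformly random match. -/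
def IsUniformMatchOn (P : Measure Ω) (game : Ω → Game) (𝓗 : MeasurableSpace Ω) (E : Set Ω)
    (z y : Ω → Word) : Prop :=
  ∀ v : Word, ∀ᵐ ω ∂P, ω ∈ E →
    (P[({ω' | y ω' = v} : Set Ω).indicator (fun _ => (1 : ℝ)) | 𝓗]) ω
      = (uniformMatch (game ω).tree (z ω) v).toReal

/-- The node selected by the rule `F` after the `k`-th match. -/
def selected (game : Ω → Game) (F : SelectionRule) (X : ℕ → Ω → unitInterval)
    (x : ℕ → Ω → Word) (k : ℕ) (ω : Ω) : Word :=
  F.select (observe (game ω) (visited x k ω)) (X k ω)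

/-- `x 1, …, x n` are the resulting leaves of `n` matches simulated by the admissible algorithm with
selection rule `F`, which uses the random numbers `X 1, …, X (n - 1)`. -/
structure IsSimulation (P : Measure Ω) (game : Ω → Game) (F : SelectionRule)
    (X : ℕ → Ω → unitInterval) (x : ℕ → Ω → Word) (n : ℕ) : Prop where
  measurable_game : Measurable game
  measurable_number : ∀ k ∈ Set.Ico 1 n, Measurable (X k)
  measurable_leaf : ∀ k ∈ Set.Icc 1 n, Measurable (x k)
  first_match : IsUniformMatchOn P game (MeasurableSpace.comap game ⊤) Set.univ (fun _ => []) (x 1)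
  uniform_number : ∀ k ∈ Set.Ico 1 n, P.map (X k) = volume
  indep_number : ∀ k ∈ Set.Ico 1 n,
    Indep (MeasurableSpace.comap (X k) inferInstance) (past game X x k) P
  old_leaf : ∀ k ∈ Set.Ico 1 n, ∀ᵐ ω ∂P,
    selected game F X x k ω ∈ visited x k ω → x (k + 1) ω = selected game F X x k ω
  new_match : ∀ k ∈ Set.Ico 1 n,
    IsUniformMatchOn P game (past game X x k ⊔ MeasurableSpace.comap (X k) inferInstance)
      {ω | selected game F X x k ω ∈ bdry game (visited x k) ω}
      (selected game F X x k) (x (k + 1))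

/-! ## Conditional minimax values and the descent -/

/-- The sigma-field generated by the set `v` of visited leaves, by its boundary, and by the outcomes
at the visited leaves. -/
abbrev knowledge (game : Ω → Game) (v : Ω → Finset Word) : MeasurableSpace Ω :=
  MeasurableSpace.comap (fun ω => observe (game ω) (v ω)) ⊤

/-- The conditional probability that `R(x) = 1` given the knowledge associated with `v`. -/
def condValue (P : Measure Ω) (game : Ω → Game) (v : Ω → Finset Word) (x : Word) : Ω → ℝ :=
  P[({ω | (game ω).value x = 1} : Set Ω).indicator (fun _ => (1 : ℝ)) | knowledge game v]

/-- `U(x)`, in terms of the tree `T` and of the conditional minimax values `ρ`. -/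
def weightU (T : Finset Word) (ρ : Word → ℝ) (x : Word) : ℝ :=
  if FirstPlays (father x) then ∏ y ∈ brothers T x, (1 - ρ y) else ∏ y ∈ brothers T x, ρ y

/-- `Z(x)`, in terms of the law `μ` of the game, of the tree `T`, of the set `xs` of visited leaves
and of the conditional minimax values `ρ`: it is `0` at visited leaves, `s(kin T x, x)` at boundary
nodes, and the maximum of `U(y) ^ 2 * Z(y)` over the children `y` of `x` at the other nodes.
(The last value `0` is never used at explored nodes.) -/
def scoreZ (μ : Measure Game) (T xs : Finset Word) (ρ : Word → ℝ) (x : Word) : ℝ :=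
  if x ∈ xs then 0
  else if x ∈ boundary T xs then meanInformation μ (kin T x) x
  else if h : (children T x).attach.Nonempty then
    (children T x).attach.sup' h (fun y => weightU T ρ y.1 ^ 2 * scoreZ μ T xs ρ y.1)
  else 0
termination_by T.sup List.length + 1 - x.length
decreasing_by exact length_lt_of_mem_children y.2

/-- One step of the descent: from a node `x` which is neither a visited leaf nor a boundary node, go
to a child `y` of `x` with maximal `U(y) ^ 2 * Z(y)` (any of them in case of equality). -/
def DescentStep (μ : Measure Game) (T xs : Finset Word) (ρ : Word → ℝ) (x y : Word) : Prop :=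
  x ∉ xs ∧ x ∉ boundary T xs ∧ y ∈ children T x ∧
    ∀ y' ∈ children T x,
      weightU T ρ y' ^ 2 * scoreZ μ T xs ρ y' ≤ weightU T ρ y ^ 2 * scoreZ μ T xs ρ y

/-- `z` is a possible result of the descent from the root, stopped as soon as it reaches a boundary
node or a visited leaf. -/
def IsDescentEnd (μ : Measure Game) (T xs : Finset Word) (ρ : Word → ℝ) (z : Word) : Prop :=
  Relation.ReflTransGen (DescentStep μ T xs ρ) [] z ∧ z ∈ boundary T xs ∪ xs

/-- The set of visited leaves after one more match started at the boundary node `z`, with resulting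
leaf `y`. It is left unchanged on the event where `z` is not in the boundary. -/
def addMatch (game : Ω → Game) (v : Ω → Finset Word) (z : Word) (y : Ω → Word) (ω : Ω) :
    Finset Word :=
  if z ∈ bdry game v ω then insert (y ω) (v ω) else v ω

/-- The conditional expectation, given the knowledge associated with `v`, of the squared error on
`R(r)` after one more match started at `z` with resulting leaf `y`. -/
def condSqError (P : Measure Ω) (game : Ω → Game) (v : Ω → Finset Word) (z : Word)
    (y : Ω → Word) : Ω → ℝ :=
  P[fun ω => (condValue P game (addMatch game v z y) [] ω - (game ω).value []) ^ 2
    | knowledge game v]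

end

end MCTS

/-!
All the random objects of the statement are discrete, so that conditional expectations are averages
over atoms (`condExp_comap_apply`), and everything reduces to the law `μ` of the game conditioned by
suitable events.

*The matches are neutral.* The probability that the algorithm visits given leaves, in a given game,
only depends on the corresponding observation: a match only sees the numbers of children of the
nodes through which it goes. Hence, knowing the observation, the law of the game is simply `μ`
conditioned by the event `consistent g₀ xs` that the game agrees with the observation
(`IsSimulation.neutral_visited`, `Neutral.neutral_addMatch`, `Neutral.map_cond`). In particular it
does not matter that the observation after one more match does not tell which match was the last.

*Independence.* That event is a product event with respect to the subgames issued from the leaves of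
`kin g₀.tree u`, for every revealed node `u` (`mem_consistent_of_subgames`). By the branching
property these subgames remain independent, and those issued from the boundary keep their law
(`indepAt_consistent`, `cond_consistent_apply`). As the minimax value of a node is a maximum or a
minimum over its children, the conditional winning probability of the root, when one learns something
about the descendants of a boundary node `z` only, is an affine function of the one of `z`, whose
slope is the product of the weights `U` along the branch from the root to `z`
(`exists_winProb_root`).

*The criterion.* By the law of total variance, the mean square error after a match from `z` is the
present variance of the value of the root, minus the variance of its new conditional winning
probability; the latter is the square of the slope times `s(kin T z, z)` (`integral_sq_error`,
`Neutral.condSqError_eq`). The error is thus minimal where this product is maximal, and the backward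
induction defining `Z` is a dynamic programming algorithm for this maximum, which the descent follows
(`pathWeight_mul_scoreZ_of_descent`, `pathWeight_mul_scoreZ_le`).

*The descent avoids the visited leaves.* It suffices that the maximum is positive when the value of
the root is not known. Going down from the root through uncertain nodes with nonzero weights, one
reaches an uncertain boundary node `z` (`exists_boundary_uncertain`). A match from `z` is then
informative: otherwise, in a fixed game of positive probability, one could go down from `z` through
uncertain nodes on which the value of `z` depends, and end at a leaf, whose outcome is revealed by a
match (`winProb_certain_of_meanInformation_eq_zero`).
-/

namespace MCTS

open MeasureTheory ProbabilityTheory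
open scoped Classical

noncomputable section

/-! ### Words, finite trees and boundaries -/

/-- `v` is a strict ancestor of `x`. -/
def StrictPrefix (v x : Word) : Prop := v <+: x ∧ v ≠ x

theorem strictPrefix_iff {v x : Word} : StrictPrefix v x ↔ ∃ k : ℕ+, v ++ [k] <+: x := by
  constructor
  · rintro ⟨⟨t, rfl⟩, h⟩
    cases t with
    | nil => simp at h
    | cons k t => exact ⟨k, t, by simp⟩
  · rintro ⟨k, t, rfl⟩
    exact ⟨⟨k :: t, by simp⟩, fun h => by simpa using congrArg List.length h⟩

theorem strictPrefix_snoc_iff {v u : Word} {k : ℕ+} : StrictPrefix v (u ++ [k]) ↔ v <+: u := by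
  rw [StrictPrefix, List.prefix_concat_iff]
  constructor
  · rintro ⟨rfl | h, h'⟩
    · exact absurd rfl h'
    · exact h
  · intro h
    refine ⟨Or.inr h, ?_⟩
    rintro rfl
    simpa using h.length_le

theorem StrictPrefix.length_lt {v x : Word} (h : StrictPrefix v x) : v.length < x.length := by
  obtain ⟨k, t, rfl⟩ := strictPrefix_iff.1 h
  simp

theorem StrictPrefix.trans_prefix {u v x : Word} (h : StrictPrefix u v) (h' : v <+: x) :
    StrictPrefix u x :=
  ⟨h.1.trans h', fun e => absurd h.length_lt (not_lt.2 (e ▸ h'.length_le))⟩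

theorem StrictPrefix.prefix_trans {u v x : Word} (h : u <+: v) (h' : StrictPrefix v x) :
    StrictPrefix u x :=
  ⟨h.trans h'.1, fun e => absurd h'.length_lt (not_lt.2 (e ▸ h.length_le))⟩

/-- Two ancestors of `x` are comparable. -/
theorem prefix_or_strictPrefix {u v x : Word} (hu : u <+: x) (hv : v <+: x) :
    u <+: v ∨ StrictPrefix v u := by
  rcases List.prefix_or_prefix_of_prefix hu hv with h | h
  · exact Or.inl h
  · by_cases e : v = u
    · exact Or.inl (e ▸ List.prefix_rfl)
    · exact Or.inr ⟨h, e⟩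

theorem mem_branch {v x : Word} : v ∈ branch x ↔ v <+: x := by
  simp [branch]

theorem mem_branches {v : Word} {xs : Finset Word} : v ∈ branches xs ↔ ∃ x ∈ xs, v <+: x := by
  simp [branches, mem_branch]

theorem mem_children {T : Finset Word} {x y : Word} :
    y ∈ children T x ↔ y ∈ T ∧ ∃ k : ℕ+, y = x ++ [k] := by
  rw [children, Finset.mem_filter, IsChild]

theorem snoc_mem_children {T : Finset Word} {x : Word} {k : ℕ+} :
    x ++ [k] ∈ children T x ↔ x ++ [k] ∈ T := by
  simp [mem_children]

theorem mem_progeny {T : Finset Word} {x y : Word} : y ∈ progeny T x ↔ y ∈ T ∧ x <+: y := by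
  simp [progeny]

theorem isBrother_snoc {u y : Word} {k : ℕ+} :
    IsBrother (u ++ [k]) y ↔ u ++ [k] ≠ y ∧ ∃ j : ℕ+, y = u ++ [j] := by
  unfold IsBrother IsChild
  refine and_congr_right fun _ => ⟨?_, ?_⟩
  · rintro ⟨v, ⟨i, hi⟩, j, rfl⟩
    have := List.append_inj' hi rfl
    exact ⟨j, by rw [this.1]⟩
  · rintro ⟨j, rfl⟩
    exact ⟨u, ⟨k, rfl⟩, j, rfl⟩

theorem brothers_snoc (T : Finset Word) (u : Word) (k : ℕ+) :
    brothers T (u ++ [k]) = (children T u).erase (u ++ [k]) := by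
  ext y
  simp only [brothers, Finset.mem_filter, isBrother_snoc, Finset.mem_erase, mem_children]
  tauto

theorem father_snoc (u : Word) (k : ℕ+) : father (u ++ [k]) = u := by
  simp [father]

theorem IsTree.mem_of_prefix {T : Finset Word} (hT : IsTree T) {v x : Word} (hx : x ∈ T)
    (h : v <+: x) : v ∈ T :=
  hT.branch_subset x hx (mem_branch.2 h)

theorem mem_leaves {T : Finset Word} {x : Word} :
    x ∈ leaves T ↔ x ∈ T ∧ ∀ y ∈ T, ¬ StrictPrefix x y := by
  simp only [leaves, Finset.mem_filter, Finset.ext_iff, mem_progeny, Finset.mem_singleton]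
  refine and_congr_right fun hx => ⟨fun h y hy hxy => ?_, fun h y => ⟨fun hy => ?_, ?_⟩⟩
  · exact hxy.2 ((h y).1 ⟨hy, hxy.1⟩).symm
  · by_contra e
    exact h y hy.1 ⟨hy.2, fun e' => e e'.symm⟩
  · rintro rfl
    exact ⟨hx, List.prefix_rfl⟩

theorem IsTree.mem_leaves_iff_children {T : Finset Word} (hT : IsTree T) {x : Word} :
    x ∈ leaves T ↔ x ∈ T ∧ children T x = ∅ := by
  rw [mem_leaves]
  refine and_congr_right fun hx => ⟨fun h => ?_, fun h y hy hxy => ?_⟩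
  · refine Finset.eq_empty_of_forall_notMem fun y hy => ?_
    obtain ⟨hy, k, rfl⟩ := mem_children.1 hy
    exact h _ hy (strictPrefix_snoc_iff.2 List.prefix_rfl)
  · obtain ⟨k, hk⟩ := strictPrefix_iff.1 hxy
    have : x ++ [k] ∈ children T x := snoc_mem_children.2 (hT.mem_of_prefix hy hk)
    simp [h] at this

theorem mem_of_mem_leaves {T : Finset Word} {x : Word} (h : x ∈ leaves T) : x ∈ T :=
  (Finset.mem_filter.1 h).1

theorem eq_of_mem_leaves {T : Finset Word} {x y : Word} (hx : x ∈ leaves T)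
    (hy : y ∈ T) (h : x <+: y) : x = y := by
  by_contra e
  exact (mem_leaves.1 hx).2 y hy ⟨h, e⟩

theorem mem_boundary_iff {T xs : Finset Word} {y : Word} :
    y ∈ boundary T xs ↔ y ∈ T ∧ (∃ v, ∃ k : ℕ+, y = v ++ [k] ∧ ∃ x ∈ xs, StrictPrefix v x) ∧
      ∀ x ∈ xs, ¬ y <+: x := by
  simp only [boundary, Finset.mem_filter, outerBoundary, Set.mem_ofPred_eq, mem_branches, not_exists,
    not_and]
  refine and_congr_right fun _ => and_congr_left fun hy => ⟨?_, ?_⟩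
  · rintro ⟨w, ⟨x, hx, hw⟩, hne, v, ⟨j, rfl⟩, k, rfl⟩
    exact ⟨v, k, rfl, x, hx, strictPrefix_iff.2 ⟨j, hw⟩⟩
  · rintro ⟨v, k, rfl, x, hx, hv⟩
    obtain ⟨j, hj⟩ := strictPrefix_iff.1 hv
    exact ⟨v ++ [j], ⟨x, hx, hj⟩, fun e => hy x hx (e ▸ hj), v, ⟨j, rfl⟩, k, rfl⟩

theorem strictPrefix_of_mem_boundary {T xs : Finset Word} {y v : Word} (hy : y ∈ boundary T xs)
    (hv : StrictPrefix v y) : ∃ x ∈ xs, StrictPrefix v x := by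
  obtain ⟨-, ⟨u, k, rfl, x, hx, hu⟩, -⟩ := mem_boundary_iff.1 hy
  exact ⟨x, hx, StrictPrefix.prefix_trans (strictPrefix_snoc_iff.1 hv) hu⟩

theorem mem_kin {T : Finset Word} {x u : Word} :
    u ∈ kin T x ↔ u ∈ T ∧ (u = [] ∨ ∃ v, ∃ k : ℕ+, StrictPrefix v x ∧ u = v ++ [k]) := by
  simp only [kin, Finset.mem_filter, mem_branch, IsChild, StrictPrefix]
  refine and_congr_right fun _ => or_congr_right ⟨?_, ?_⟩
  · rintro ⟨v, hv, hne, k, rfl⟩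
    exact ⟨v, k, ⟨hv, hne⟩, rfl⟩
  · rintro ⟨v, k, ⟨hv, hne⟩, rfl⟩
    exact ⟨v, hv, hne, k, rfl⟩

theorem mem_kin_of_prefix {T : Finset Word} (hT : IsTree T) {x u : Word} (hx : x ∈ T)
    (h : u <+: x) : u ∈ kin T x := by
  refine mem_kin.2 ⟨hT.mem_of_prefix hx h, ?_⟩
  induction u using List.reverseRecOn with
  | nil => exact Or.inl rfl
  | append_singleton v k _ => exact Or.inr ⟨v, k, strictPrefix_iff.2 ⟨k, h⟩, rfl⟩

theorem isTree_kin {T : Finset Word} (hT : IsTree T) {x : Word} (hx : x ∈ T) :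
    IsTree (kin T x) := by
  refine ⟨mem_kin.2 ⟨hT.root_mem, Or.inl rfl⟩, fun u hu v hv => ?_⟩
  rw [mem_branch] at hv
  obtain ⟨huT, rfl | ⟨w, k, hw, rfl⟩⟩ := mem_kin.1 hu
  · rw [List.prefix_nil.1 hv]
    exact hu
  · rcases List.prefix_concat_iff.1 hv with rfl | h
    · exact hu
    · exact mem_kin_of_prefix hT hx (h.trans hw.1)

theorem mem_leaves_kin {T : Finset Word} (hT : IsTree T) {x u : Word} (hx : x ∈ T) :
    u ∈ leaves (kin T x) ↔ u ∈ kin T x ∧ ¬ StrictPrefix u x := by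
  rw [mem_leaves]
  refine and_congr_right fun hu => ⟨fun h h' => h x (mem_kin_of_prefix hT hx List.prefix_rfl) h',
    fun h y hy hxy => ?_⟩
  obtain ⟨-, rfl | ⟨w, k, hw, rfl⟩⟩ := mem_kin.1 hy
  · exact absurd hxy.length_lt (by simp)
  · exact h (StrictPrefix.prefix_trans (strictPrefix_snoc_iff.1 hxy) hw)

theorem self_mem_leaves_kin {T : Finset Word} (hT : IsTree T) {x : Word} (hx : x ∈ T) :
    x ∈ leaves (kin T x) :=
  (mem_leaves_kin hT hx).2 ⟨mem_kin_of_prefix hT hx List.prefix_rfl, fun h => h.2 rfl⟩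

theorem mem_leaves_kin_of_mem_children {T : Finset Word} (hT : IsTree T) {u w : Word} {k : ℕ+}
    (hk : u ++ [k] ∈ T) (hw : w ∈ children T u) : w ∈ leaves (kin T (u ++ [k])) := by
  obtain ⟨hw, j, rfl⟩ := mem_children.1 hw
  refine (mem_leaves_kin hT hk).2
    ⟨mem_kin.2 ⟨hw, Or.inr ⟨u, j, strictPrefix_snoc_iff.2 List.prefix_rfl, rfl⟩⟩, fun h => ?_⟩
  have := h.length_lt
  simp at this

/-- Every node of `T` which is not a strict ancestor of `x` descends from a leaf of `kin T x`. -/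
theorem exists_leaf_kin_prefix {T : Finset Word} (hT : IsTree T) {x v : Word} (hx : x ∈ T)
    (hv : v ∈ T) (h : ¬ StrictPrefix v x) : ∃ w ∈ leaves (kin T x), w <+: v := by
  induction v using List.reverseRecOn with
  | nil =>
    exact ⟨[], (mem_leaves_kin hT hx).2 ⟨mem_kin.2 ⟨hv, Or.inl rfl⟩, h⟩, List.prefix_rfl⟩
  | append_singleton v k ih =>
    by_cases hvx : StrictPrefix v x
    · exact ⟨v ++ [k], (mem_leaves_kin hT hx).2 ⟨mem_kin.2 ⟨hv, Or.inr ⟨v, k, hvx, rfl⟩⟩, h⟩,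
        List.prefix_rfl⟩
    · obtain ⟨w, hw, hwv⟩ := ih (hT.mem_of_prefix hv (List.prefix_append _ _)) hvx
      exact ⟨w, hw, hwv.trans (List.prefix_append _ _)⟩

/-! ### Events on which part of the game is known -/

/-- The games which contain `z` and coincide with `g₀` as far as the children of the strict
ancestors of `z` are concerned. -/
def explored (g₀ : Game) (z : Word) : Set Game :=
  {g | z ∈ g.tree ∧ ∀ v, StrictPrefix v z → children g.tree v = children g₀.tree v}

/-- The games which give the same observation as `g₀` when the set of visited leaves is `xs`, see
`mem_consistent_iff_observe`. -/
def consistent (g₀ : Game) (xs : Finset Word) : Set Game :=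
  {g | xs ⊆ leaves g.tree ∧
    (∀ x ∈ xs, ∀ v, StrictPrefix v x → children g.tree v = children g₀.tree v) ∧
    ∀ x ∈ xs, (x ∈ g.wins ↔ x ∈ g₀.wins)}

/-- The games for which a match from `z` to the leaf `y` provides the same information as in `g₁`,
see `matchInfo_eq_iff`. -/
def matchEvent (z : Word) (g₁ : Game) (y : Word) : Set Game :=
  {g | y ∈ leaves g.tree ∧
    (∀ v, z <+: v → StrictPrefix v y → children g.tree v = children g₁.tree v) ∧
    (y ∈ g.wins ↔ y ∈ g₁.wins)}

theorem exploredEvent_kin (g₀ : Game) {z : Word} (hz : z ∈ g₀.tree) :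
    exploredEvent (kin g₀.tree z) = explored g₀ z := by
  have hK := isTree_kin g₀.isTree hz
  ext g
  simp only [exploredEvent, explored, Set.mem_ofPred_eq]
  constructor
  · rintro ⟨hsub, hb⟩
    refine ⟨hsub (mem_kin_of_prefix g₀.isTree hz List.prefix_rfl), fun v hv => ?_⟩
    ext w
    constructor
    · intro hw
      obtain ⟨hw, k, rfl⟩ := mem_children.1 hw
      refine snoc_mem_children.2 ?_
      by_contra hw'
      have : v ++ [k] ∈ boundary g.tree (leaves (kin g₀.tree z)) := by
        refine mem_boundary_iff.2 ⟨hw, ⟨v, k, rfl, z, self_mem_leaves_kin g₀.isTree hz, hv⟩,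
          fun x hx hk => hw' ?_⟩
        exact g₀.isTree.mem_of_prefix (mem_kin.1 (mem_of_mem_leaves hx)).1 hk
      simp [hb] at this
    · intro hw
      obtain ⟨hw, k, rfl⟩ := mem_children.1 hw
      exact snoc_mem_children.2 (hsub (mem_kin.2 ⟨hw, Or.inr ⟨v, k, hv, rfl⟩⟩))
  · rintro ⟨hzg, h⟩
    refine ⟨fun u hu => ?_, Finset.eq_empty_of_forall_notMem fun y hy => ?_⟩
    · obtain ⟨hu, rfl | ⟨v, k, hv, rfl⟩⟩ := mem_kin.1 hu
      · exact g.isTree.root_mem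
      · exact snoc_mem_children.1 (h v hv ▸ snoc_mem_children.2 hu)
    · obtain ⟨hyg, ⟨v, k, rfl, x, hx, hvx⟩, hno⟩ := mem_boundary_iff.1 hy
      have hvz : StrictPrefix v z := by
        obtain ⟨-, rfl | ⟨w, j, hw, rfl⟩⟩ := mem_kin.1 (mem_of_mem_leaves hx)
        · exact absurd hvx.length_lt (by simp)
        · exact StrictPrefix.prefix_trans (strictPrefix_snoc_iff.1 hvx) hw
      have hy₀ : v ++ [k] ∈ g₀.tree :=
        snoc_mem_children.1 (h v hvz ▸ snoc_mem_children.2 hyg)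
      by_cases hs : StrictPrefix (v ++ [k]) z
      · exact hno z (self_mem_leaves_kin g₀.isTree hz) hs.1
      · exact hno _ ((mem_leaves_kin g₀.isTree hz).2
          ⟨mem_kin.2 ⟨hy₀, Or.inr ⟨v, k, hvz, rfl⟩⟩, hs⟩) List.prefix_rfl

theorem self_mem_explored {g₀ : Game} {z : Word} (hz : z ∈ g₀.tree) : g₀ ∈ explored g₀ z :=
  ⟨hz, fun _ _ => rfl⟩

theorem self_mem_consistent {g₀ : Game} {xs : Finset Word} (h : xs ⊆ leaves g₀.tree) :
    g₀ ∈ consistent g₀ xs :=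
  ⟨h, fun _ _ _ _ => rfl, fun _ _ => Iff.rfl⟩

theorem consistent_eq {g g₀ : Game} {xs : Finset Word} (h : g ∈ consistent g₀ xs) :
    consistent g xs = consistent g₀ xs := by
  ext g'
  constructor
  · exact fun h' => ⟨h'.1, fun x hx v hv => (h'.2.1 x hx v hv).trans (h.2.1 x hx v hv),
      fun x hx => (h'.2.2 x hx).trans (h.2.2 x hx)⟩
  · exact fun h' => ⟨h'.1, fun x hx v hv => (h'.2.1 x hx v hv).trans (h.2.1 x hx v hv).symm,
      fun x hx => (h'.2.2 x hx).trans (h.2.2 x hx).symm⟩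

theorem consistent_mono {g g₀ : Game} {xs xs' : Finset Word} (hxs : xs ⊆ xs')
    (h : g ∈ consistent g₀ xs') : g ∈ consistent g₀ xs :=
  ⟨hxs.trans h.1, fun x hx => h.2.1 x (hxs hx), fun x hx => h.2.2 x (hxs hx)⟩

theorem mem_consistent_iff_observe {g g₀ : Game} {xs : Finset Word} (h₀ : xs ⊆ leaves g₀.tree) :
    g ∈ consistent g₀ xs ↔ xs ⊆ leaves g.tree ∧ observe g xs = observe g₀ xs := by
  refine and_congr_right fun h => ?_
  have hmem : ∀ g : Game, xs ⊆ leaves g.tree → ∀ (v : Word) (k : ℕ+),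
      (∃ x ∈ xs, StrictPrefix v x) →
      (v ++ [k] ∈ g.tree ↔ (∃ x ∈ xs, v ++ [k] <+: x) ∨ v ++ [k] ∈ boundary g.tree xs) := by
    intro g hg v k hv
    constructor
    · intro hk
      by_cases hx : ∃ x ∈ xs, v ++ [k] <+: x
      · exact Or.inl hx
      · push Not at hx
        exact Or.inr (mem_boundary_iff.2 ⟨hk, ⟨v, k, rfl, hv⟩, hx⟩)
    · rintro (⟨x, hx, hk⟩ | hk)
      · exact g.isTree.mem_of_prefix (mem_of_mem_leaves (hg hx)) hk
      · exact (mem_boundary_iff.1 hk).1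
  simp only [observe, Observation.mk.injEq, true_and]
  refine and_congr ⟨fun hc => ?_, fun hb x hx v hv => ?_⟩ ?_
  · ext y
    simp only [mem_boundary_iff]
    refine and_congr_left ?_
    rintro ⟨⟨v, k, rfl, x, hx, hv⟩, -⟩
    rw [← snoc_mem_children, hc x hx v hv, snoc_mem_children]
  · ext y
    simp only [mem_children]
    refine and_congr_left ?_
    rintro ⟨k, rfl⟩
    rw [hmem g h v k ⟨x, hx, hv⟩, hmem g₀ h₀ v k ⟨x, hx, hv⟩, hb]
  · simp only [Finset.ext_iff, Finset.mem_inter]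
    exact ⟨fun h x => and_congr_right fun hx => h x hx,
      fun h x hx => by simpa [hx] using h x⟩

/-- A node all of whose strict ancestors have been explored belongs to the games which are
consistent with the observation. -/
theorem consistent_subset_explored {g₀ : Game} {xs : Finset Word} {u : Word} (hu : u ∈ g₀.tree)
    (hxs : ∀ v, StrictPrefix v u → ∃ x ∈ xs, StrictPrefix v x) :
    consistent g₀ xs ⊆ explored g₀ u := by
  intro g hg
  have h : ∀ v, StrictPrefix v u → children g.tree v = children g₀.tree v := by
    intro v hv
    obtain ⟨x, hx, hvx⟩ := hxs v hv
    exact hg.2.1 x hx v hvx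
  refine ⟨?_, h⟩
  induction u using List.reverseRecOn with
  | nil => exact g.isTree.root_mem
  | append_singleton v k _ =>
    have := h v (strictPrefix_snoc_iff.2 List.prefix_rfl)
    exact snoc_mem_children.1 (this ▸ snoc_mem_children.2 hu)

theorem subgame_eq_iff {g g' : Game} {w : Word} :
    g.subgame w = g'.subgame w ↔ ∀ y, w <+: y →
      ((y ∈ g.tree ↔ y ∈ g'.tree) ∧ (y ∈ g.wins ↔ y ∈ g'.wins)) := by
  simp only [Game.subgame, Prod.mk.injEq, Finset.ext_iff, mem_progeny, Finset.mem_filter]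
  constructor
  · rintro ⟨h, h'⟩ y hy
    have := h y
    have := h' y
    tauto
  · intro h
    exact ⟨fun y => and_congr_left fun hy => (h y hy).1,
      fun y => and_congr_left fun hy => (h y hy).2⟩

theorem subgame_eq_of_prefix {g g' : Game} {u w : Word} (huw : u <+: w)
    (h : g.subgame u = g'.subgame u) : g.subgame w = g'.subgame w :=
  subgame_eq_iff.2 fun y hy => subgame_eq_iff.1 h y (huw.trans hy)

theorem children_eq_of_subgame_eq {g g' : Game} {w v : Word} (h : g.subgame w = g'.subgame w)
    (hv : w <+: v) : children g.tree v = children g'.tree v := by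
  ext y
  simp only [mem_children]
  refine and_congr_left ?_
  rintro ⟨k, rfl⟩
  exact (subgame_eq_iff.1 h _ (hv.trans (List.prefix_append _ _))).1

theorem mem_leaves_of_subgame_eq {g g' : Game} {w v : Word} (h : g.subgame w = g'.subgame w)
    (hv : w <+: v) : v ∈ leaves g.tree ↔ v ∈ leaves g'.tree := by
  rw [g.isTree.mem_leaves_iff_children, g'.isTree.mem_leaves_iff_children,
    children_eq_of_subgame_eq h hv, (subgame_eq_iff.1 h v hv).1]

/-- The event of being consistent with an observation is a product event: it constrains separately
the subgames issued from the leaves of `kin g₀.tree u`, and those issued from unexplored leaves are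
not constrained at all. -/
theorem mem_consistent_of_subgames {g₀ g : Game} {xs : Finset Word} {u : Word}
    (h₀ : xs ⊆ leaves g₀.tree) (hu : u ∈ g₀.tree) (hg : g ∈ explored g₀ u)
    (h : ∀ w ∈ leaves (kin g₀.tree u), (∃ x ∈ xs, w <+: x) →
      ∃ g' ∈ consistent g₀ xs, g.subgame w = g'.subgame w) :
    g ∈ consistent g₀ xs := by
  have hx' : ∀ x ∈ xs, ∃ g' ∈ consistent g₀ xs, ∃ w, w <+: x ∧ g.subgame w = g'.subgame w := by
    intro x hx
    obtain ⟨w, hw, hwx⟩ := exists_leaf_kin_prefix g₀.isTree hu (mem_of_mem_leaves (h₀ hx))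
      (fun hs => (mem_leaves.1 (h₀ hx)).2 u hu hs)
    obtain ⟨g', hg', e⟩ := h w hw ⟨x, hx, hwx⟩
    exact ⟨g', hg', w, hwx, e⟩
  refine ⟨fun x hx => ?_, fun x hx v hv => ?_, fun x hx => ?_⟩
  · obtain ⟨g', hg', w, hwx, e⟩ := hx' x hx
    exact (mem_leaves_of_subgame_eq e hwx).2 (hg'.1 hx)
  · by_cases hvu : StrictPrefix v u
    · exact hg.2 v hvu
    · obtain ⟨w, hw, hwv⟩ := exists_leaf_kin_prefix g₀.isTree hu
        (g₀.isTree.mem_of_prefix (mem_of_mem_leaves (h₀ hx)) hv.1) hvu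
      obtain ⟨g', hg', e⟩ := h w hw ⟨x, hx, hwv.trans hv.1⟩
      rw [children_eq_of_subgame_eq e hwv]
      exact hg'.2.1 x hx v hv
  · obtain ⟨g', hg', w, hwx, e⟩ := hx' x hx
    rw [(subgame_eq_iff.1 e x hwx).2]
    exact hg'.2.2 x hx

theorem explored_inter_matchEvent {g₀ g₁ : Game} {z y : Word} (hg₁ : g₁ ∈ explored g₀ z)
    (hzy : z <+: y) : explored g₀ z ∩ matchEvent z g₁ y = consistent g₁ {y} := by
  ext g
  simp only [consistent, Finset.singleton_subset_iff, Finset.mem_singleton, forall_eq,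
    Set.mem_inter_iff, Set.mem_ofPred_eq]
  constructor
  · rintro ⟨⟨hz, h⟩, hy, h', hw⟩
    refine ⟨hy, fun v hv => ?_, hw⟩
    rcases prefix_or_strictPrefix hzy hv.1 with hzv | hvz
    · exact h' v hzv hv
    · rw [h v hvz, hg₁.2 v hvz]
  · rintro ⟨hy, h, hw⟩
    refine ⟨⟨g.isTree.mem_of_prefix (mem_of_mem_leaves hy) hzy, fun v hv => ?_⟩,
      hy, fun v _ hv => h v hv, hw⟩
    rw [h v (hv.trans_prefix hzy), hg₁.2 v hv]

theorem consistent_inter_matchEvent {g₀ g₁ : Game} {xs : Finset Word} {z y : Word}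
    (hz : ∀ v, StrictPrefix v z → ∃ x ∈ xs, StrictPrefix v x)
    (hg₁ : g₁ ∈ consistent g₀ xs) (hzy : z <+: y) :
    consistent g₀ xs ∩ matchEvent z g₁ y = consistent g₁ (insert y xs) := by
  rw [← consistent_eq hg₁]
  ext g
  simp only [consistent, Finset.insert_subset_iff, Finset.forall_mem_insert, Set.mem_inter_iff,
    Set.mem_ofPred_eq, matchEvent]
  constructor
  · rintro ⟨⟨hs, h, hw⟩, hy, h', hw'⟩
    refine ⟨⟨hy, hs⟩, ⟨fun v hv => ?_, h⟩, hw', hw⟩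
    rcases prefix_or_strictPrefix hzy hv.1 with hzv | hvz
    · exact h' v hzv hv
    · obtain ⟨x, hx, hvx⟩ := hz v hvz
      exact h x hx v hvx
  · rintro ⟨⟨hy, hs⟩, ⟨h', h⟩, hw', hw⟩
    exact ⟨⟨hs, h, hw⟩, hy, fun v _ hv => h' v hv, hw'⟩

theorem matchInfo_eq_iff {z y y' : Word} {g g' : Game} (hy : y ∈ leaves g.tree)
    (hy' : y' ∈ leaves g'.tree) (hzy : z <+: y) :
    matchInfo z (g', y') = matchInfo z (g, y) ↔ y' = y ∧ g' ∈ matchEvent z g y := by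
  simp only [matchInfo, Prod.mk.injEq, decide_eq_decide]
  refine and_congr_right ?_
  rintro rfl
  have hk : ∀ g : Game, z ∈ g.tree → ∀ u, u ∈ (kin g.tree y').filter (fun u => z <+: u) ↔
      u = z ∨ (u ∈ g.tree ∧ ∃ v, ∃ k : ℕ+, z <+: v ∧ StrictPrefix v y' ∧ u = v ++ [k]) := by
    intro g hzg u
    simp only [Finset.mem_filter, mem_kin]
    constructor
    · rintro ⟨⟨hu, rfl | ⟨v, k, hv, rfl⟩⟩, hzu⟩
      · exact Or.inl (List.prefix_nil.1 hzu).symm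
      · rcases List.prefix_concat_iff.1 hzu with e | e
        · exact Or.inl e.symm
        · exact Or.inr ⟨hu, v, k, e, hv, rfl⟩
    · rintro (rfl | ⟨hu, v, k, hzv, hv, rfl⟩)
      · refine ⟨⟨hzg, ?_⟩, List.prefix_rfl⟩
        exact (mem_kin.1 (mem_kin_of_prefix g.isTree
          (g.isTree.mem_of_prefix hzg List.prefix_rfl) List.prefix_rfl)).2.imp id
          (fun ⟨v, k, h, e⟩ => ⟨v, k, h.trans_prefix hzy, e⟩)
      · exact ⟨⟨hu, Or.inr ⟨v, k, hv, rfl⟩⟩, hzv.trans (List.prefix_append _ _)⟩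
  have hz : z ∈ g.tree := g.isTree.mem_of_prefix (mem_of_mem_leaves hy) hzy
  have hz' : z ∈ g'.tree := g'.isTree.mem_of_prefix (mem_of_mem_leaves hy') hzy
  simp only [matchEvent, Set.mem_ofPred_eq, hy', true_and]
  refine and_congr_left fun _ => ?_
  rw [Finset.ext_iff]
  simp only [hk g hz, hk g' hz']
  constructor
  · intro h v hzv hv
    ext u
    simp only [mem_children]
    refine and_congr_left ?_
    rintro ⟨k, rfl⟩
    have hne : v ++ [k] ≠ z := by
      rintro rfl
      simpa using hzv.length_le
    have := h (v ++ [k])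
    simp only [hne, false_or] at this
    have hex : ∃ v', ∃ j : ℕ+, z <+: v' ∧ StrictPrefix v' y' ∧ v ++ [k] = v' ++ [j] :=
      ⟨v, k, hzv, hv, rfl⟩
    rwa [and_iff_left hex, and_iff_left hex] at this
  · intro h u
    refine or_congr_right (and_congr_left ?_)
    rintro ⟨v, k, hzv, hv, rfl⟩
    rw [← snoc_mem_children, h v hzv hv, snoc_mem_children]

/-! ### Minimax values -/

theorem Game.exists_legal (g : Game) : ∃ σ : Word → Word,
    ∀ u ∈ g.tree, u ∉ leaves g.tree → σ u ∈ children g.tree u := by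
  have : ∀ u, ∃ w, u ∈ g.tree → u ∉ leaves g.tree → w ∈ children g.tree u := by
    intro u
    by_cases h : u ∈ g.tree ∧ u ∉ leaves g.tree
    · rw [g.isTree.mem_leaves_iff_children, not_and] at h
      obtain ⟨w, hw⟩ := Finset.nonempty_iff_ne_empty.2 (h.2 h.1)
      exact ⟨w, fun _ _ => hw⟩
    · exact ⟨[], fun h₁ h₂ => absurd ⟨h₁, h₂⟩ h⟩
  choose σ hσ using this
  exact ⟨σ, hσ⟩

theorem Game.firstWinsFrom_of_subgame_eq {g g' : Game} {x : Word}
    (h : g.subgame x = g'.subgame x) (hw : g.FirstWinsFrom x) : g'.FirstWinsFrom x := by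
  obtain ⟨σ, hσ, hwin⟩ := hw
  obtain ⟨δ, hδ⟩ := g'.exists_legal
  refine ⟨fun u => if x <+: u then σ u else δ u, fun u hu hul hp => ?_, fun y hy hxy hc => ?_⟩
  · dsimp only
    split_ifs with hxu
    · rw [← children_eq_of_subgame_eq h hxu]
      exact hσ u ((subgame_eq_iff.1 h u hxu).1.2 hu)
        (fun hl => hul ((mem_leaves_of_subgame_eq h hxu).1 hl)) hp
    · exact hδ u hu hul
  · refine (subgame_eq_iff.1 h y hxy).2.1 (hwin y ((mem_leaves_of_subgame_eq h hxy).2 hy) hxy ?_)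
    intro u hu hxu huy hp
    simpa [hxu] using hc u hu hxu huy hp

theorem Game.value_eq_of_subgame_eq {g g' : Game} {x : Word}
    (h : g.subgame x = g'.subgame x) : g.value x = g'.value x := by
  have : g.FirstWinsFrom x ↔ g'.FirstWinsFrom x :=
    ⟨Game.firstWinsFrom_of_subgame_eq h, Game.firstWinsFrom_of_subgame_eq h.symm⟩
  simp [Game.value, this]

theorem Game.firstWinsFrom_leaf {g : Game} {x : Word} (hx : x ∈ leaves g.tree) :
    g.FirstWinsFrom x ↔ x ∈ g.wins := by
  constructor
  · rintro ⟨σ, -, h⟩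
    refine h x hx List.prefix_rfl fun u hu hxu hne _ => absurd ?_ hne
    exact (mem_branch.1 hu).eq_of_length_le hxu.length_le
  · intro hw
    obtain ⟨σ, hσ⟩ := g.exists_legal
    refine ⟨σ, fun u hu hl _ => hσ u hu hl, fun y hy hxy _ => ?_⟩
    rwa [← eq_of_mem_leaves hx (mem_of_mem_leaves hy) hxy]

/-- At his own nodes, the first player wins when some move is winning. -/
theorem Game.firstWinsFrom_iff_exists {g : Game} {x : Word} (hx : x ∈ g.tree)
    (hl : x ∉ leaves g.tree) (hp : FirstPlays x) :
    g.FirstWinsFrom x ↔ ∃ c ∈ children g.tree x, g.FirstWinsFrom c := by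
  constructor
  · rintro ⟨σ, hσ, hwin⟩
    have hc := hσ x hx hl hp
    refine ⟨σ x, hc, σ, hσ, fun y hy hcy hcons => ?_⟩
    obtain ⟨hcT, k, hk⟩ := mem_children.1 hc
    have hxc : x <+: σ x := hk ▸ List.prefix_append _ _
    refine hwin y hy (hxc.trans hcy) fun u hu hxu huy hpu => ?_
    by_cases hux : u = x
    · rw [hux]
      exact mem_branch.2 hcy
    · refine hcons u hu ?_ huy hpu
      rcases prefix_or_strictPrefix hcy (mem_branch.1 hu) with h | h
      · exact h
      · rw [hk, strictPrefix_snoc_iff] at h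
        exact absurd (h.eq_of_length_le hxu.length_le) hux
  · rintro ⟨c, hc, σ, hσ, hwin⟩
    refine ⟨fun u => if u = x then c else σ u, fun u hu hul hpu => ?_, fun y hy hxy hcons => ?_⟩
    · dsimp only
      split_ifs with h
      · rw [h]
        exact hc
      · exact hσ u hu hul hpu
    · obtain ⟨hcT, k, rfl⟩ := mem_children.1 hc
      have hcy := hcons x (mem_branch.2 hxy) List.prefix_rfl (fun e => hl (e ▸ hy)) hp
      simp only [if_true, mem_branch] at hcy
      refine hwin y hy hcy fun u hu hcu huy hpu => ?_
      have hux : u ≠ x := by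
        rintro rfl
        simpa using hcu.length_le
      simpa [hux] using hcons u hu ((List.prefix_append _ _).trans hcu) huy hpu

/-- At the nodes of his opponent, the first player wins when all the moves are winning: strategies
from the children can be glued together. -/
theorem Game.firstWinsFrom_iff_forall {g : Game} {x : Word}
    (hl : x ∉ leaves g.tree) (hp : ¬ FirstPlays x) :
    g.FirstWinsFrom x ↔ ∀ c ∈ children g.tree x, g.FirstWinsFrom c := by
  constructor
  · rintro ⟨σ, hσ, hwin⟩ c hc
    obtain ⟨hcT, k, rfl⟩ := mem_children.1 hc
    refine ⟨σ, hσ, fun y hy hcy hcons => ?_⟩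
    refine hwin y hy ((List.prefix_append _ _).trans hcy) fun u hu hxu huy hpu => ?_
    refine hcons u hu ?_ huy hpu
    rcases prefix_or_strictPrefix hcy (mem_branch.1 hu) with h | h
    · exact h
    · rw [strictPrefix_snoc_iff] at h
      exact absurd ((h.eq_of_length_le hxu.length_le) ▸ hpu) hp
  · intro h
    choose! σ hσ hwin using h
    obtain ⟨δ, hδ⟩ := g.exists_legal
    -- The strategy followed at `u` is that of the child of `x` from which `u` descends.
    refine ⟨fun u => if u.take (x.length + 1) ∈ children g.tree x then
      σ (u.take (x.length + 1)) u else δ u, fun u hu hul hpu => ?_, fun y hy hxy hcons => ?_⟩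
    · dsimp only
      split_ifs with hc
      · exact hσ _ hc u hu hul hpu
      · exact hδ u hu hul
    · have hne : x ≠ y := fun e => hl (e ▸ hy)
      obtain ⟨k, hk⟩ := strictPrefix_iff.1 ⟨hxy, hne⟩
      have hc : x ++ [k] ∈ children g.tree x :=
        snoc_mem_children.2 (g.isTree.mem_of_prefix (mem_of_mem_leaves hy) hk)
      refine hwin _ hc y hy hk fun u hu hcu huy hpu => ?_
      have htake : u.take (x.length + 1) = x ++ [k] := by
        rw [List.prefix_iff_eq_take] at hcu
        simpa using hcu.symm
      have := hcons u hu ((List.prefix_append _ _).trans hcu) huy hpu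
      simpa only [htake, hc, if_true] using this

theorem Game.value_eq_one_iff {g : Game} {x : Word} : g.value x = 1 ↔ g.FirstWinsFrom x := by
  simp [Game.value]

/-! ### Uniformly random matches -/

instance : DiscreteMeasurableSpace Word := ⟨fun _ => trivial⟩
instance : DiscreteMeasurableSpace (Finset Word) := ⟨fun _ => trivial⟩
instance : DiscreteMeasurableSpace Game := ⟨fun _ => trivial⟩
instance : DiscreteMeasurableSpace Observation := ⟨fun _ => trivial⟩

instance : Countable Observation :=
  Function.Injective.countable (f := fun o : Observation => (o.visited, o.bdry, o.wins)) (by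
    rintro ⟨a, b, c⟩ ⟨a', b', c'⟩ h
    simpa using h)

theorem uniformMatch_of_children_eq_empty {T : Finset Word} {x : Word} (h : children T x = ∅) :
    uniformMatch T x = PMF.pure x := by
  rw [uniformMatch, dif_neg]
  simp [h]

theorem uniformMatch_apply_of_nonempty {T : Finset Word} {x v : Word}
    (h : (children T x).Nonempty) :
    uniformMatch T x v
      = ∑ c ∈ children T x, ((children T x).card : ENNReal)⁻¹ * uniformMatch T c v := by
  have h' : (children T x).attach.Nonempty := by simpa using h
  rw [uniformMatch, dif_pos h', PMF.bind_apply, tsum_fintype,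
    ← Finset.sum_coe_sort (children T x)
      (fun c => ((children T x).card : ENNReal)⁻¹ * uniformMatch T c v)]
  refine Finset.sum_congr rfl fun c _ => ?_
  simp [PMF.uniformOfFinset_apply]

theorem uniformMatch_support {T : Finset Word} (hT : IsTree T) {x v : Word} (hx : x ∈ T)
    (hv : uniformMatch T x v ≠ 0) : v ∈ leaves T ∧ x <+: v := by
  induction hn : T.sup List.length + 1 - x.length using Nat.strong_induction_on generalizing x with
  | _ n ih =>
    rcases (children T x).eq_empty_or_nonempty with h | h
    · rw [uniformMatch_of_children_eq_empty h, PMF.pure_apply] at hv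
      obtain rfl : v = x := by
        by_contra e
        simp [e] at hv
      exact ⟨hT.mem_leaves_iff_children.2 ⟨hx, h⟩, List.prefix_rfl⟩
    · rw [uniformMatch_apply_of_nonempty h] at hv
      obtain ⟨c, hc, hc'⟩ := Finset.exists_ne_zero_of_sum_ne_zero hv
      have hlt := length_lt_of_mem_children hc
      obtain ⟨hcT, k, rfl⟩ := mem_children.1 hc
      obtain ⟨h₁, h₂⟩ := ih _ (hn ▸ hlt) hcT (right_ne_zero_of_mul hc') rfl
      exact ⟨h₁, (List.prefix_append _ _).trans h₂⟩

theorem uniformMatch_leaf {T : Finset Word} (hT : IsTree T) {x : Word} (hx : x ∈ leaves T) :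
    uniformMatch T x x = 1 := by
  rw [uniformMatch_of_children_eq_empty (hT.mem_leaves_iff_children.1 hx).2]
  simp

theorem uniformMatch_step {T : Finset Word} (hT : IsTree T) {x v : Word} {k : ℕ+}
    (hk : x ++ [k] <+: v) (hv : v ∈ T) :
    uniformMatch T x v = ((children T x).card : ENNReal)⁻¹ * uniformMatch T (x ++ [k]) v := by
  have hc : x ++ [k] ∈ children T x := snoc_mem_children.2 (hT.mem_of_prefix hv hk)
  rw [uniformMatch_apply_of_nonempty ⟨_, hc⟩]
  refine Finset.sum_eq_single _ (fun c hc' hne => ?_) (fun h => absurd hc h)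
  obtain ⟨hcT, j, rfl⟩ := mem_children.1 hc'
  rw [mul_eq_zero]
  right
  by_contra h
  have := List.prefix_of_prefix_length_le (uniformMatch_support hT hcT h).2 hk (by simp)
  exact hne (this.eq_of_length (by simp))

theorem uniformMatch_ne_zero {T : Finset Word} (hT : IsTree T) {x v : Word} (hxv : x <+: v)
    (hv : v ∈ leaves T) : uniformMatch T x v ≠ 0 := by
  obtain ⟨t, rfl⟩ := hxv
  induction t generalizing x with
  | nil =>
    rw [List.append_nil] at hv ⊢
    rw [uniformMatch_leaf hT hv]
    exact one_ne_zero
  | cons k t ih =>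
    have e : x ++ k :: t = (x ++ [k]) ++ t := by simp
    rw [e] at hv ⊢
    rw [uniformMatch_step hT (List.prefix_append _ _) (mem_of_mem_leaves hv)]
    exact mul_ne_zero (by simp) (ih hv)

/-- The probability that a match from `z` leads to `y` only depends on the numbers of children of
the nodes between `z` and `y`. -/
theorem uniformMatch_eq_of_mem_matchEvent {z y : Word} {g g' : Game} (hzy : z <+: y)
    (hy : y ∈ leaves g.tree) (hg' : g' ∈ matchEvent z g y) :
    uniformMatch g'.tree z y = uniformMatch g.tree z y := by
  obtain ⟨hy', h, -⟩ := hg'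
  obtain ⟨t, rfl⟩ := hzy
  induction t generalizing z with
  | nil =>
    rw [List.append_nil] at hy hy' ⊢
    rw [uniformMatch_leaf g.isTree hy, uniformMatch_leaf g'.isTree hy']
  | cons k t ih =>
    have e : z ++ k :: t = (z ++ [k]) ++ t := by simp
    rw [e] at hy hy' h ⊢
    rw [uniformMatch_step g.isTree (List.prefix_append _ _) (mem_of_mem_leaves hy),
      uniformMatch_step g'.isTree (List.prefix_append _ _) (mem_of_mem_leaves hy'),
      ih hy hy' fun v hv => h v ((List.prefix_append _ _).trans hv),
      h z List.prefix_rfl (strictPrefix_iff.2 ⟨k, List.prefix_append _ _⟩)]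

theorem matchKernel_singleton (z : Word) (g : Game) (y : Word) :
    matchKernel z g {y} = uniformMatch g.tree z y :=
  PMF.toMeasure_apply_singleton _ _ (measurableSet_singleton y)

/-- The joint law of the game and of the information provided by a match from `z`. -/
theorem compProd_matchInfo (ν : Measure Game) [SFinite ν] {z y : Word} {g₁ : Game}
    (hz : ∀ᵐ g ∂ν, z ∈ g.tree) (hy : y ∈ leaves g₁.tree) (hzy : z <+: y) (B : Set Game) :
    (ν ⊗ₘ matchKernel z) {p | p.1 ∈ B ∧ matchInfo z p = matchInfo z (g₁, y)}
      = uniformMatch g₁.tree z y * ν (B ∩ matchEvent z g₁ y) := by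
  rw [Measure.compProd_apply (MeasurableSet.of_discrete),
    ← lintegral_indicator_const (MeasurableSet.of_discrete)]
  refine lintegral_congr_ae ?_
  filter_upwards [hz] with g hzg
  have hsub : Prod.mk g ⁻¹' {p : Game × Word | p.1 ∈ B ∧ matchInfo z p = matchInfo z (g₁, y)}
      ⊆ {y} := by
    rintro y' ⟨-, h⟩
    exact congrArg Prod.fst h
  by_cases hyg : y ∈ leaves g.tree
  · by_cases hg : g ∈ B ∩ matchEvent z g₁ y
    · have : Prod.mk g ⁻¹' {p : Game × Word | p.1 ∈ B ∧ matchInfo z p = matchInfo z (g₁, y)}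
          = {y} := by
        refine hsub.antisymm ?_
        rintro _ rfl
        exact ⟨hg.1, (matchInfo_eq_iff hy hyg hzy).2 ⟨rfl, hg.2⟩⟩
      rw [this, Set.indicator_of_mem hg, matchKernel_singleton,
        uniformMatch_eq_of_mem_matchEvent hzy hy hg.2]
    · rw [Set.indicator_of_notMem hg]
      refine measure_mono_null (t := ∅) ?_ measure_empty
      intro y' hy'
      obtain rfl : y' = y := hsub hy'
      exact hg ⟨hy'.1, ((matchInfo_eq_iff hy hyg hzy).1 hy'.2).2⟩
  · rw [Set.indicator_of_notMem fun hg => hyg hg.2.1]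
    refine measure_mono_null hsub ?_
    rw [matchKernel_singleton]
    by_contra h
    exact hyg (uniformMatch_support g.isTree hzg h).1

theorem compProd_matchKernel_singleton (ν : Measure Game) [SFinite ν] (z : Word)
    (p : Game × Word) :
    (ν ⊗ₘ matchKernel z) {p} = ν {p.1} * uniformMatch p.1.tree z p.2 := by
  obtain ⟨g, y⟩ := p
  rw [← Set.singleton_prod_singleton,
    Measure.compProd_apply_prod (measurableSet_singleton _) (measurableSet_singleton _),
    lintegral_singleton, matchKernel_singleton, mul_comm]

theorem cond_compProd (μ : Measure Game) [IsFiniteMeasure μ] (A : Set Game) (z : Word) :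
    (μ ⊗ₘ matchKernel z)[|Prod.fst ⁻¹' A] = μ[|A] ⊗ₘ matchKernel z := by
  have hA : (μ ⊗ₘ matchKernel z) (Prod.fst ⁻¹' A) = μ A := by
    rw [← Measure.fst_apply (MeasurableSet.of_discrete), Measure.fst_compProd]
  refine Measure.ext_of_singleton fun p => ?_
  rw [compProd_matchKernel_singleton, cond_apply (MeasurableSet.of_discrete),
    cond_apply (MeasurableSet.of_discrete), hA, mul_assoc]
  congr 1
  by_cases hp : p.1 ∈ A
  · have h₁ : Prod.fst ⁻¹' A ∩ {p} = {p} := by simpa using hp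
    have h₂ : A ∩ {p.1} = {p.1} := by simpa using hp
    rw [h₁, h₂, compProd_matchKernel_singleton]
  · have h₁ : Prod.fst ⁻¹' A ∩ {p} = ∅ := by simpa using hp
    have h₂ : A ∩ {p.1} = ∅ := by simpa using hp
    simp [h₁, h₂]

/-! ### Conditional expectations given a discrete random variable -/

theorem measureReal_cond_apply {Ω : Type*} [MeasurableSpace Ω] {P : Measure Ω} {A : Set Ω}
    (hA : MeasurableSet A) (S : Set Ω) : (P[|A]).real S = (P.real A)⁻¹ * P.real (A ∩ S) := by
  simp [measureReal_def, cond_apply hA]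

/-- On an atom of positive probability, the conditional expectation given a random variable is the
average over the atom. This holds at every point, because a function which is measurable with
respect to the random variable is constant on its atoms. -/
theorem condExp_comap_apply {Ω ι : Type*} [mΩ : MeasurableSpace Ω] (P : Measure Ω)
    [IsFiniteMeasure P] [mι : MeasurableSpace ι] [MeasurableSingletonClass ι] {Y : Ω → ι}
    (hY : Measurable Y) {f : Ω → ℝ} (hf : Integrable f P) {ω : Ω}
    (hω : P (Y ⁻¹' {Y ω}) ≠ 0) :
    (P[f | MeasurableSpace.comap Y mι]) ω = ∫ ω', f ω' ∂(P[|Y ⁻¹' {Y ω}]) := by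
  have hm : MeasurableSpace.comap Y mι ≤ mΩ := hY.comap_le
  have hmeas : MeasurableSet[MeasurableSpace.comap Y mι] (Y ⁻¹' {Y ω}) :=
    ⟨_, measurableSet_singleton _, rfl⟩
  have h := setIntegral_condExp hm hf hmeas
  have hc : ∀ ω' ∈ Y ⁻¹' {Y ω}, (P[f | MeasurableSpace.comap Y mι]) ω'
      = (P[f | MeasurableSpace.comap Y mι]) ω := fun ω' h' =>
    StronglyMeasurable.factorsThrough
      (stronglyMeasurable_condExp (m := MeasurableSpace.comap Y mι)) h'
  rw [setIntegral_congr_fun (hm _ hmeas) hc, setIntegral_const, smul_eq_mul] at h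
  have h0 : P.real (Y ⁻¹' {Y ω}) ≠ 0 := by
    rwa [Ne, measureReal_eq_zero_iff]
  rw [ProbabilityTheory.cond, integral_smul_measure, ← h, smul_eq_mul, ENNReal.toReal_inv, ← measureReal_def,
    ← mul_assoc, inv_mul_cancel₀ h0, one_mul]

theorem condExp_indicator_comap_apply {Ω ι : Type*} [mΩ : MeasurableSpace Ω] (P : Measure Ω)
    [IsFiniteMeasure P] [mι : MeasurableSpace ι] [MeasurableSingletonClass ι] {Y : Ω → ι}
    (hY : Measurable Y) {S : Set Ω} (hS : MeasurableSet S) {ω : Ω}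
    (hω : P (Y ⁻¹' {Y ω}) ≠ 0) :
    (P[S.indicator (fun _ => (1 : ℝ)) | MeasurableSpace.comap Y mι]) ω
      = (P[|Y ⁻¹' {Y ω}]).real S := by
  rw [condExp_comap_apply P hY ((integrable_const 1).indicator hS) hω,
    integral_indicator_const _ hS, smul_eq_mul, mul_one]

/-- Almost every point belongs to an atom of positive probability of a discrete random variable. -/
theorem ae_preimage_singleton_ne_zero {Ω ι : Type*} [MeasurableSpace Ω] (P : Measure Ω)
    [Countable ι] (Y : Ω → ι) : ∀ᵐ ω ∂P, P (Y ⁻¹' {Y ω}) ≠ 0 := by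
  have : P (⋃ i ∈ {i | P (Y ⁻¹' {i}) = 0}, Y ⁻¹' {i}) = 0 :=
    (measure_biUnion_null_iff (Set.to_countable _)).2 fun i hi => hi
  rw [ae_iff]
  refine measure_mono_null (fun ω hω => ?_) this
  simp only [not_not, Set.mem_ofPred_eq] at hω
  simpa using hω

/-! ### Conditional independence of the subgames -/

/-- The event `F` only depends on the subgame issued from `u`. -/
def DeterminedAt (u : Word) (F : Set Game) : Prop :=
  ∀ ⦃g g' : Game⦄, g.subgame u = g'.subgame u → g ∈ F → g' ∈ F

theorem DeterminedAt.of_prefix {u w : Word} {F : Set Game} (hF : DeterminedAt w F)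
    (h : u <+: w) : DeterminedAt u F :=
  fun _ _ e => hF (subgame_eq_of_prefix h e)

theorem DeterminedAt.compl {u : Word} {F : Set Game} (hF : DeterminedAt u F) :
    DeterminedAt u Fᶜ :=
  fun _ _ e h h' => h (hF e.symm h')

theorem DeterminedAt.inter {u : Word} {F F' : Set Game} (hF : DeterminedAt u F)
    (hF' : DeterminedAt u F') : DeterminedAt u (F ∩ F') :=
  fun _ _ e h => ⟨hF e h.1, hF' e h.2⟩

theorem determinedAt_univ (u : Word) : DeterminedAt u Set.univ :=
  fun _ _ _ _ => trivial

theorem determinedAt_value (u : Word) : DeterminedAt u {g | g.value u = 1} := by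
  intro g g' e h
  simpa [Game.value_eq_of_subgame_eq e] using h

theorem determinedAt_matchEvent {z y : Word} (hzy : z <+: y) (g₁ : Game) :
    DeterminedAt z (matchEvent z g₁ y) := by
  rintro g g' e ⟨hy, h, hw⟩
  refine ⟨(mem_leaves_of_subgame_eq e hzy).1 hy, fun v hzv hv => ?_, ?_⟩
  · rw [← children_eq_of_subgame_eq e hzv, h v hzv hv]
  · rw [← (subgame_eq_iff.1 e y hzy).2, hw]

theorem DeterminedAt.measurableSet_comap {u : Word} {F : Set Game} (hF : DeterminedAt u F) :
    MeasurableSet[MeasurableSpace.comap (fun g : Game => g.subgame u) inferInstance] F := by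
  refine ⟨(fun g : Game => g.subgame u) '' F, MeasurableSet.of_discrete, ?_⟩
  ext g
  constructor
  · rintro ⟨g', hg', e⟩
    exact hF e hg'
  · exact fun h => ⟨g, h, rfl⟩

/-- The family, indexed by the leaves of the tree `kin g₀.tree u`, of the subgames issued from
these leaves. -/
def kinSubgames (g₀ : Game) (u : Word) (w : {w // w ∈ leaves (kin g₀.tree u)}) (g : Game) :
    Finset Word × Finset Word :=
  g.subgame w.1

/-- Under `μ` conditioned by `E`, the node `u` and its environment are as in `g₀`, and the subgames
issued from the leaves of `kin g₀.tree u` are independent. -/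
structure IndepAt (μ : Measure Game) (E : Set Game) (g₀ : Game) (u : Word) : Prop where
  subset_explored : E ⊆ explored g₀ u
  indep : iIndepFun (kinSubgames g₀ u) (μ[|E])

theorem indepAt_explored {μ : Measure Game} (hb : BranchingProperty μ) {g₀ : Game} {u : Word}
    (hu : u ∈ g₀.tree) (hpos : μ (explored g₀ u) ≠ 0) : IndepAt μ (explored g₀ u) g₀ u := by
  refine ⟨subset_rfl, ?_⟩
  rw [← exploredEvent_kin g₀ hu] at hpos ⊢
  exact hb _ (isTree_kin g₀.isTree hu) hpos

/-- The constraint imposed by `consistent g₀ xs` on the subgame issued from `w`. -/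
def subgameConstraint (g₀ : Game) (xs : Finset Word) (w : Word) : Set (Finset Word × Finset Word) :=
  if ∃ x ∈ xs, w <+: x then (fun g : Game => g.subgame w) '' consistent g₀ xs else Set.univ

theorem consistent_eq_inter {g₀ : Game} {xs : Finset Word} {u : Word} (h₀ : xs ⊆ leaves g₀.tree)
    (hu : u ∈ g₀.tree) (hxs : ∀ v, StrictPrefix v u → ∃ x ∈ xs, StrictPrefix v x) :
    consistent g₀ xs
      = explored g₀ u ∩ ⋂ w, kinSubgames g₀ u w ⁻¹' subgameConstraint g₀ xs w.1 := by
  ext g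
  constructor
  · intro hg
    refine ⟨consistent_subset_explored hu hxs hg, Set.mem_iInter.2 fun w => ?_⟩
    rw [Set.mem_preimage, subgameConstraint]
    split_ifs
    · exact ⟨g, hg, rfl⟩
    · trivial
  · rintro ⟨hg, h⟩
    refine mem_consistent_of_subgames h₀ hu hg fun w hw hwx => ?_
    have := Set.mem_iInter.1 h ⟨w, hw⟩
    rw [Set.mem_preimage, subgameConstraint, if_pos hwx] at this
    obtain ⟨g', hg', e⟩ := this
    exact ⟨g', hg', e.symm⟩

theorem cond_explored_constraint_ne_zero {μ : Measure Game} [IsFiniteMeasure μ] {g₀ : Game}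
    {xs : Finset Word} {u : Word} (h₀ : xs ⊆ leaves g₀.tree) (hu : u ∈ g₀.tree)
    (hxs : ∀ v, StrictPrefix v u → ∃ x ∈ xs, StrictPrefix v x)
    (hpos : μ (consistent g₀ xs) ≠ 0) (w : {w // w ∈ leaves (kin g₀.tree u)}) :
    (μ[|explored g₀ u]) (kinSubgames g₀ u w ⁻¹' subgameConstraint g₀ xs w.1) ≠ 0 := by
  intro h
  refine hpos ?_
  have := measure_mono_null
    (Set.iInter_subset (fun w => kinSubgames g₀ u w ⁻¹' subgameConstraint g₀ xs w.1) w) h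
  rw [cond_apply MeasurableSet.of_discrete, ← consistent_eq_inter h₀ hu hxs, mul_eq_zero] at this
  exact this.resolve_left (ENNReal.inv_ne_zero.2 (measure_ne_top _ _))

theorem indepAt_consistent {μ : Measure Game} [IsProbabilityMeasure μ] (hb : BranchingProperty μ)
    {g₀ : Game} {xs : Finset Word} {u : Word} (h₀ : xs ⊆ leaves g₀.tree)
    (hu : u ∈ g₀.tree) (hxs : ∀ v, StrictPrefix v u → ∃ x ∈ xs, StrictPrefix v x)
    (hpos : μ (consistent g₀ xs) ≠ 0) : IndepAt μ (consistent g₀ xs) g₀ u := by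
  have hsub := consistent_subset_explored hu hxs
  have hpos' : μ (explored g₀ u) ≠ 0 := fun h => hpos (measure_mono_null hsub h)
  refine ⟨hsub, ?_⟩
  have hν := (indepAt_explored hb hu hpos').indep
  have hne := cond_explored_constraint_ne_zero h₀ hu hxs hpos
  have h := iIndepFun.cond (X := kinSubgames g₀ u) (Y := kinSubgames g₀ u)
    (t := fun w => subgameConstraint g₀ xs w.1)
    (fun w => Measurable.of_discrete)
    (hν.comp (fun _ s => (s, s)) fun _ => Measurable.of_discrete) hne
    (fun _ => MeasurableSet.of_discrete)
  rwa [cond_cond_eq_cond_inter MeasurableSet.of_discrete MeasurableSet.of_discrete,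
    ← consistent_eq_inter h₀ hu hxs] at h

/-- The visited leaves bring no information on the subgame issued from an unexplored node. -/
theorem cond_consistent_apply {μ : Measure Game} [IsProbabilityMeasure μ]
    (hb : BranchingProperty μ) {g₀ : Game} {xs : Finset Word} {z : Word}
    (h₀ : xs ⊆ leaves g₀.tree) (hz : z ∈ boundary g₀.tree xs)
    (hpos : μ (consistent g₀ xs) ≠ 0) {F : Set Game} (hF : DeterminedAt z F) :
    (μ[|consistent g₀ xs]) F = (μ[|explored g₀ z]) F := by
  have hu : z ∈ g₀.tree := (mem_boundary_iff.1 hz).1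
  have hxs := fun v => strictPrefix_of_mem_boundary (v := v) hz
  have hsub := consistent_subset_explored hu hxs
  have hpos' : μ (explored g₀ z) ≠ 0 := fun h => hpos (measure_mono_null hsub h)
  have hν := (indepAt_explored hb hu hpos').indep
  have := cond_isProbabilityMeasure hpos'
  have hne := cond_explored_constraint_ne_zero h₀ hu hxs hpos
  let z' : {w // w ∈ leaves (kin g₀.tree z)} := ⟨z, self_mem_leaves_kin g₀.isTree hu⟩
  have h := cond_iInter (X := kinSubgames g₀ z) (Y := kinSubgames g₀ z)
    (t := fun w => subgameConstraint g₀ xs w.1) (s := {z'}) (f := fun _ => F)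
    (fun w => Measurable.of_discrete)
    (hν.comp (fun _ s => (s, s)) fun _ => Measurable.of_discrete)
    (by
      intro i hi
      rw [Finset.mem_singleton] at hi
      rw [hi]
      exact hF.measurableSet_comap)
    (fun w _ => hne w) (fun _ => MeasurableSet.of_discrete)
  rw [cond_cond_eq_cond_inter MeasurableSet.of_discrete MeasurableSet.of_discrete,
    ← consistent_eq_inter h₀ hu hxs] at h
  have hfree : subgameConstraint g₀ xs z = Set.univ := by
    rw [subgameConstraint, if_neg]
    rintro ⟨x, hx, hzx⟩
    exact (mem_boundary_iff.1 hz).2.2 x hx hzx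
  simpa [z', hfree] using h

/-- The product formula for events about the children of `u`, in the presence of an event `F` about
the descendants of one of them. -/
theorem IndepAt.measureReal_inter {μ : Measure Game} {E : Set Game} {g₀ : Game} {u : Word} {k : ℕ+}
    (hE : IndepAt μ E g₀ (u ++ [k])) (hk : u ++ [k] ∈ g₀.tree) {F : Set Game}
    (hF : DeterminedAt (u ++ [k]) F) {G : Word → Set Game} (hG : ∀ c, DeterminedAt c (G c)) :
    (μ[|E]).real (F ∩ ⋂ c ∈ children g₀.tree u, G c)
      = (μ[|E]).real (F ∩ G (u ++ [k]))
        * ∏ c ∈ brothers g₀.tree (u ++ [k]), (μ[|E]).real (G c) := by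
  have hc : u ++ [k] ∈ children g₀.tree u := snoc_mem_children.2 hk
  have hleaf : ∀ c ∈ children g₀.tree u, c ∈ leaves (kin g₀.tree (u ++ [k])) :=
    fun c => mem_leaves_kin_of_mem_children g₀.isTree hk
  let H : Word → Set Game := fun c => if c = u ++ [k] then F ∩ G c else G c
  have hH : ∀ c, DeterminedAt c (H c) := by
    intro c
    dsimp only [H]
    split_ifs with e
    · rw [e]
      exact hF.inter (hG _)
    · exact hG c
  have hset : F ∩ ⋂ c ∈ children g₀.tree u, G c = ⋂ c ∈ children g₀.tree u, H c := by
    ext g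
    simp only [Set.mem_inter_iff, Set.mem_iInter, H]
    constructor
    · rintro ⟨hf, h⟩ c hc'
      split_ifs
      · exact ⟨hf, h c hc'⟩
      · exact h c hc'
    · intro h
      have h0 := h _ hc
      rw [if_pos rfl] at h0
      refine ⟨h0.1, fun c hc' => ?_⟩
      have h1 := h c hc'
      split_ifs at h1
      · exact h1.2
      · exact h1
  have hprod := hE.indep.meas_biInter
    (S := (children g₀.tree u).subtype (fun c => c ∈ leaves (kin g₀.tree (u ++ [k]))))
    (s := fun c => H c.1) (fun c _ => (hH c.1).measurableSet_comap)
  have hset' : (⋂ c ∈ (children g₀.tree u).subtype (fun c => c ∈ leaves (kin g₀.tree (u ++ [k]))),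
      H c.1) = ⋂ c ∈ children g₀.tree u, H c := by
    ext g
    simp only [Set.mem_iInter, Finset.mem_subtype]
    exact ⟨fun h c hc' => h ⟨c, hleaf c hc'⟩ hc', fun h c hc' => h c.1 hc'⟩
  rw [hset', Finset.prod_subtype_of_mem (fun c => (μ[|E]) (H c)) hleaf,
    ← Finset.mul_prod_erase _ _ hc, ← brothers_snoc] at hprod
  rw [hset, measureReal_def, hprod, ENNReal.toReal_mul, ENNReal.toReal_prod]
  refine congrArg₂ _ (by simp [H, measureReal_def]) (Finset.prod_congr rfl fun c hc' => ?_)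
  rw [brothers_snoc] at hc'
  simp [H, Finset.ne_of_mem_erase hc', measureReal_def]

/-! ### Posterior winning probabilities -/

/-- The probability that the minimax value of `x` is `1`, knowing the event `E`. -/
def winProb (μ : Measure Game) (E : Set Game) (x : Word) : ℝ :=
  (μ[|E]).real {g | g.value x = 1}

theorem winProb_nonneg (μ : Measure Game) (E : Set Game) (x : Word) : 0 ≤ winProb μ E x :=
  measureReal_nonneg

theorem winProb_le_one {μ : Measure Game} [IsFiniteMeasure μ] {E : Set Game} (x : Word) :
    winProb μ E x ≤ 1 := by
  by_cases h : μ E = 0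
  · simp [winProb, measureReal_def, cond_eq_zero_of_meas_eq_zero h]
  · have := cond_isProbabilityMeasure h
    exact measureReal_le_one

theorem value_of_mem_explored_of_firstPlays {g g₀ : Game} {u : Word} {k : ℕ+}
    (hg : g ∈ explored g₀ (u ++ [k])) (hp : FirstPlays u) :
    g.value u ≠ 1 ↔ ∀ c ∈ children g₀.tree u, g.value c ≠ 1 := by
  have hs : StrictPrefix u (u ++ [k]) := strictPrefix_snoc_iff.2 List.prefix_rfl
  have hl : u ∉ leaves g.tree := fun h => (mem_leaves.1 h).2 _ hg.1 hs
  rw [← hg.2 u hs, Ne, Game.value_eq_one_iff,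
    Game.firstWinsFrom_iff_exists (g.isTree.mem_of_prefix hg.1 hs.1) hl hp]
  simp [Game.value_eq_one_iff]

theorem value_of_mem_explored_of_not_firstPlays {g g₀ : Game} {u : Word} {k : ℕ+}
    (hg : g ∈ explored g₀ (u ++ [k])) (hp : ¬ FirstPlays u) :
    g.value u = 1 ↔ ∀ c ∈ children g₀.tree u, g.value c = 1 := by
  have hs : StrictPrefix u (u ++ [k]) := strictPrefix_snoc_iff.2 List.prefix_rfl
  have hl : u ∉ leaves g.tree := fun h => (mem_leaves.1 h).2 _ hg.1 hs
  rw [← hg.2 u hs, Game.value_eq_one_iff, Game.firstWinsFrom_iff_forall hl hp]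
  simp [Game.value_eq_one_iff]

theorem weightU_snoc (T : Finset Word) (ρ : Word → ℝ) (u : Word) (k : ℕ+) :
    weightU T ρ (u ++ [k]) = if FirstPlays u then ∏ c ∈ brothers T (u ++ [k]), (1 - ρ c)
      else ∏ c ∈ brothers T (u ++ [k]), ρ c := by
  rw [weightU, father_snoc]

theorem one_sub_winProb {μ : Measure Game} [IsFiniteMeasure μ] {E : Set Game} (hE : μ E ≠ 0)
    (x : Word) : 1 - winProb μ E x = (μ[|E]).real {g | g.value x = 1}ᶜ := by
  have := cond_isProbabilityMeasure hE
  rw [probReal_compl_eq_one_sub MeasurableSet.of_discrete, winProb]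

/-- Knowing an event `F` about the descendants of the child `u ++ [k]` of `u`, the winning
probability at `u` is an affine function of the winning probability at this child. -/
theorem IndepAt.exists_winProb_step {μ : Measure Game} [IsFiniteMeasure μ] {E : Set Game}
    {g₀ : Game} {u : Word} {k : ℕ+} (hE : IndepAt μ E g₀ (u ++ [k])) (hk : u ++ [k] ∈ g₀.tree) :
    ∃ a : ℝ, ∀ F, DeterminedAt (u ++ [k]) F → μ (E ∩ F) ≠ 0 →
      winProb μ (E ∩ F) u
        = a + weightU g₀.tree (winProb μ E) (u ++ [k]) * winProb μ (E ∩ F) (u ++ [k]) := by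
  rw [weightU_snoc]
  have key : ∀ F, DeterminedAt (u ++ [k]) F → μ (E ∩ F) ≠ 0 → ∀ G : Word → Set Game,
      (∀ c, DeterminedAt c (G c)) →
      (∀ g ∈ explored g₀ (u ++ [k]), g ∈ G u ↔ ∀ c ∈ children g₀.tree u, g ∈ G c) →
      (μ[|E ∩ F]).real (G u) = (μ[|E ∩ F]).real (G (u ++ [k]))
        * ∏ c ∈ brothers g₀.tree (u ++ [k]), (μ[|E]).real (G c) := by
    intro F hF hpos G hG hGu
    rw [← cond_cond_eq_cond_inter MeasurableSet.of_discrete MeasurableSet.of_discrete,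
      measureReal_cond_apply (P := μ[|E]) (A := F) MeasurableSet.of_discrete,
      measureReal_cond_apply (P := μ[|E]) (A := F) MeasurableSet.of_discrete, mul_assoc, ← hE.measureReal_inter hk hF hG]
    congr 1
    refine measureReal_congr ?_
    filter_upwards [ae_cond_mem (μ := μ) (MeasurableSet.of_discrete (s := E))] with g hg
    refine propext ?_
    change g ∈ F ∧ g ∈ G u ↔ g ∈ F ∧ g ∈ ⋂ c ∈ children g₀.tree u, G c
    rw [hGu g (hE.subset_explored hg)]
    simp
  by_cases hp : FirstPlays u
  · refine ⟨1 - ∏ c ∈ brothers g₀.tree (u ++ [k]), (1 - winProb μ E c), fun F hF hpos => ?_⟩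
    have hE0 : μ E ≠ 0 := fun h => hpos (measure_mono_null Set.inter_subset_left h)
    have h := key F hF hpos (fun c => {g | g.value c = 1}ᶜ)
      (fun c => (determinedAt_value c).compl)
      (fun g hg => value_of_mem_explored_of_firstPlays hg hp)
    simp only [← one_sub_winProb hpos, ← one_sub_winProb hE0] at h
    rw [if_pos hp]
    linarith
  · refine ⟨0, fun F hF hpos => ?_⟩
    have h := key F hF hpos (fun c => {g | g.value c = 1}) determinedAt_value
      (fun g hg => value_of_mem_explored_of_not_firstPlays hg hp)
    rw [if_neg hp, zero_add, mul_comm]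
    exact h

/-- Backward induction for the winning probabilities. -/
theorem IndepAt.winProb_eq_prod {μ : Measure Game} [IsFiniteMeasure μ] {E : Set Game}
    {g₀ : Game} {u : Word} {k : ℕ+} (hE : IndepAt μ E g₀ (u ++ [k])) (hk : u ++ [k] ∈ g₀.tree)
    (hpos : μ E ≠ 0) :
    (FirstPlays u → 1 - winProb μ E u = ∏ c ∈ children g₀.tree u, (1 - winProb μ E c)) ∧
      (¬ FirstPlays u → winProb μ E u = ∏ c ∈ children g₀.tree u, winProb μ E c) := by
  have hc : u ++ [k] ∈ children g₀.tree u := snoc_mem_children.2 hk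
  have key : ∀ G : Word → Set Game, (∀ c, DeterminedAt c (G c)) →
      (∀ g ∈ explored g₀ (u ++ [k]), g ∈ G u ↔ ∀ c ∈ children g₀.tree u, g ∈ G c) →
      (μ[|E]).real (G u) = ∏ c ∈ children g₀.tree u, (μ[|E]).real (G c) := by
    intro G hG hGu
    have h := hE.measureReal_inter hk (determinedAt_univ _) hG
    rw [Set.univ_inter, Set.univ_inter, brothers_snoc,
      Finset.mul_prod_erase _ (fun c => (μ[|E]).real (G c)) hc] at h
    rw [← h]
    refine measureReal_congr ?_
    filter_upwards [ae_cond_mem (μ := μ) (MeasurableSet.of_discrete (s := E))] with g hg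
    refine propext ?_
    change g ∈ G u ↔ g ∈ ⋂ c ∈ children g₀.tree u, G c
    rw [hGu g (hE.subset_explored hg)]
    simp
  constructor
  · intro hp
    have h := key (fun c => {g | g.value c = 1}ᶜ) (fun c => (determinedAt_value c).compl)
      (fun g hg => value_of_mem_explored_of_firstPlays hg hp)
    simpa only [← one_sub_winProb hpos] using h
  · intro hp
    exact key (fun c => {g | g.value c = 1}) determinedAt_value
      (fun g hg => value_of_mem_explored_of_not_firstPlays hg hp)

/-- If the value of `u` is not known, then all the weights below `u` are nonzero, and the value of
some child of `u` is not known. -/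
theorem IndepAt.exists_child_uncertain {μ : Measure Game} [IsFiniteMeasure μ] {E : Set Game}
    {g₀ : Game} {u : Word} {k : ℕ+} (hE : IndepAt μ E g₀ (u ++ [k])) (hk : u ++ [k] ∈ g₀.tree)
    (hpos : μ E ≠ 0) (h0 : 0 < winProb μ E u) (h1 : winProb μ E u < 1) :
    ∃ c ∈ children g₀.tree u, weightU g₀.tree (winProb μ E) c ≠ 0 ∧
      0 < winProb μ E c ∧ winProb μ E c < 1 := by
  obtain ⟨hp₁, hp₂⟩ := hE.winProb_eq_prod hk hpos
  have hbr : ∀ c ∈ children g₀.tree u, brothers g₀.tree c ⊆ children g₀.tree u := by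
    intro c hc
    obtain ⟨-, j, rfl⟩ := mem_children.1 hc
    rw [brothers_snoc]
    exact Finset.erase_subset _ _
  have hfa : ∀ c ∈ children g₀.tree u, father c = u := by
    intro c hc
    obtain ⟨-, j, rfl⟩ := mem_children.1 hc
    exact father_snoc u j
  by_cases hp : FirstPlays u
  · have h := hp₁ hp
    have hne : ∀ c ∈ children g₀.tree u, 1 - winProb μ E c ≠ 0 := by
      rw [← Finset.prod_ne_zero_iff, ← h]
      linarith
    obtain ⟨c, hc, hc1⟩ : ∃ c ∈ children g₀.tree u, 1 - winProb μ E c ≠ 1 := by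
      by_contra! hall
      rw [Finset.prod_eq_one hall] at h
      linarith
    refine ⟨c, hc, ?_, lt_of_le_of_ne (winProb_nonneg _ _ _) fun e => hc1 ?_,
      lt_of_le_of_ne (winProb_le_one _) fun e => hne c hc ?_⟩
    · rw [weightU, hfa c hc, if_pos hp, Finset.prod_ne_zero_iff]
      exact fun w hw => hne w (hbr c hc hw)
    · rw [← e, sub_zero]
    · rw [e, sub_self]
  · have h := hp₂ hp
    have hne : ∀ c ∈ children g₀.tree u, winProb μ E c ≠ 0 := by
      rw [← Finset.prod_ne_zero_iff, ← h]
      exact h0.ne'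
    obtain ⟨c, hc, hc1⟩ : ∃ c ∈ children g₀.tree u, winProb μ E c ≠ 1 := by
      by_contra! hall
      rw [Finset.prod_eq_one hall] at h
      linarith
    refine ⟨c, hc, ?_, lt_of_le_of_ne (winProb_nonneg _ _ _) (hne c hc).symm,
      lt_of_le_of_ne (winProb_le_one _) hc1⟩
    rw [weightU, hfa c hc, if_neg hp, Finset.prod_ne_zero_iff]
    exact fun w hw => hne w (hbr c hc hw)

/-- The product of the weights of the nodes of the branch from the root to `z`, except the root. -/
def pathWeight (T : Finset Word) (ρ : Word → ℝ) (z : Word) : ℝ :=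
  ∏ v ∈ (branch z).erase [], weightU T ρ v

theorem pathWeight_nil (T : Finset Word) (ρ : Word → ℝ) : pathWeight T ρ [] = 1 := by
  simp [pathWeight, branch]

theorem pathWeight_snoc (T : Finset Word) (ρ : Word → ℝ) (u : Word) (k : ℕ+) :
    pathWeight T ρ (u ++ [k]) = pathWeight T ρ u * weightU T ρ (u ++ [k]) := by
  have : (branch (u ++ [k])).erase [] = insert (u ++ [k]) ((branch u).erase []) := by
    ext v
    simp only [Finset.mem_erase, Finset.mem_insert, mem_branch, List.prefix_concat_iff]
    constructor
    · tauto
    · rintro (rfl | h)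
      · simp
      · tauto
  rw [pathWeight, this, Finset.prod_insert, mul_comm, pathWeight]
  simp only [Finset.mem_erase, mem_branch, not_and]
  intro _ h
  simpa using h.length_le

/-- Knowing an event `F` about the descendants of `z`, the winning probability at the root is an
affine function of the winning probability at `z`, the slope of which is the product of the weights
along the branch. -/
theorem exists_winProb_root {μ : Measure Game} [IsFiniteMeasure μ] {E : Set Game}
    {g₀ : Game} {z : Word} (hz : z ∈ g₀.tree) (hE : ∀ v, v <+: z → IndepAt μ E g₀ v) :
    ∃ a : ℝ, ∀ F, DeterminedAt z F → μ (E ∩ F) ≠ 0 →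
      winProb μ (E ∩ F) [] = a + pathWeight g₀.tree (winProb μ E) z * winProb μ (E ∩ F) z := by
  induction z using List.reverseRecOn with
  | nil => exact ⟨0, fun F _ _ => by rw [pathWeight_nil]; ring⟩
  | append_singleton u k ih =>
    have huk : u <+: u ++ [k] := List.prefix_append _ _
    obtain ⟨a, ha⟩ := ih (g₀.isTree.mem_of_prefix hz huk) fun v hv => hE v (hv.trans huk)
    obtain ⟨b, hb⟩ := (hE _ List.prefix_rfl).exists_winProb_step hz
    refine ⟨a + pathWeight g₀.tree (winProb μ E) u * b, fun F hF hpos => ?_⟩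
    rw [ha F (hF.of_prefix huk) hpos, hb F hF hpos, pathWeight_snoc]
    ring

/-! ### The information provided by a match -/

/-- The joint law of a game of law `μ` conditioned by `E`, and of the resulting leaf of a uniformly
random match in this game started at `z`. -/
abbrev matchLaw (μ : Measure Game) (E : Set Game) (z : Word) : Measure (Game × Word) :=
  μ[|E] ⊗ₘ matchKernel z

/-- The minimax value of `x`, as a function of a pair formed by a game and a leaf. -/
abbrev winIndicator (x : Word) : Game × Word → ℝ :=
  ({p | p.1.value x = 1} : Set (Game × Word)).indicator (fun _ => (1 : ℝ))

/-- The conditional probability that `R(x) = 1` given the information provided by a match from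
`z`. -/
abbrev matchPosterior (Q : Measure (Game × Word)) (z x : Word) : Game × Word → ℝ :=
  Q[winIndicator x | MeasurableSpace.comap (matchInfo z) inferInstance]

theorem measurable_matchInfo (z : Word) : Measurable (matchInfo z) := Measurable.of_discrete

theorem matchLaw_support {μ : Measure Game} [IsFiniteMeasure μ] {E : Set Game} {z : Word}
    (hz : ∀ g ∈ E, z ∈ g.tree) {p : Game × Word} (hp : matchLaw μ E z {p} ≠ 0) :
    p.1 ∈ E ∧ μ {p.1} ≠ 0 ∧ p.2 ∈ leaves p.1.tree ∧ z <+: p.2 := by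
  rw [matchLaw, compProd_matchKernel_singleton, cond_apply MeasurableSet.of_discrete] at hp
  have h1 : p.1 ∈ E := by
    by_contra h
    simp [h] at hp
  have h2 : E ∩ {p.1} = {p.1} := by simpa using h1
  rw [h2] at hp
  exact ⟨h1, fun h => by simp [h] at hp,
    uniformMatch_support p.1.isTree (hz _ h1) (right_ne_zero_of_mul hp)⟩

theorem matchLaw_singleton_ne_zero {μ : Measure Game} [IsFiniteMeasure μ] {E : Set Game} {z : Word}
    {p : Game × Word} (hp : p.1 ∈ E) (hpos : μ {p.1} ≠ 0) (hl : p.2 ∈ leaves p.1.tree)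
    (hz : z <+: p.2) : matchLaw μ E z {p} ≠ 0 := by
  have h2 : E ∩ {p.1} = {p.1} := by simpa using hp
  rw [matchLaw, compProd_matchKernel_singleton, cond_apply MeasurableSet.of_discrete, h2]
  exact mul_ne_zero (mul_ne_zero (ENNReal.inv_ne_zero.2 (measure_ne_top _ _)) hpos)
    (uniformMatch_ne_zero p.1.isTree hz hl)

theorem ae_singleton_ne_zero {α : Type*} [MeasurableSpace α] [Countable α] (Q : Measure α) :
    ∀ᵐ p ∂Q, Q {p} ≠ 0 := by
  simpa using ae_preimage_singleton_ne_zero Q (fun p : α => p)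

theorem ae_mem_tree {μ : Measure Game} {E : Set Game} {z : Word}
    (hz : ∀ g ∈ E, z ∈ g.tree) : ∀ᵐ g ∂(μ[|E]), z ∈ g.tree := by
  filter_upwards [ae_cond_mem (μ := μ) (MeasurableSet.of_discrete (s := E))] with g hg
  exact hz g hg

/-- Given the information provided by a match from `z` to `y` in `g₁`, the game is conditioned by
`matchEvent z g₁ y`. -/
theorem matchPosterior_apply {μ : Measure Game} [IsFiniteMeasure μ] {E : Set Game} {z : Word}
    (hz : ∀ g ∈ E, z ∈ g.tree) (x : Word) {p : Game × Word} (hp : matchLaw μ E z {p} ≠ 0) :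
    μ (E ∩ matchEvent z p.1 p.2) ≠ 0 ∧
    matchPosterior (matchLaw μ E z) z x p = winProb μ (E ∩ matchEvent z p.1 p.2) x := by
  obtain ⟨hpE, hpμ, hpl, hpz⟩ := matchLaw_support hz hp
  have hself : p.1 ∈ matchEvent z p.1 p.2 := ⟨hpl, fun _ _ _ => rfl, Iff.rfl⟩
  refine ⟨fun h => hpμ (measure_mono_null (by simpa using ⟨hpE, hself⟩) h), ?_⟩
  have hfib : matchLaw μ E z (matchInfo z ⁻¹' {matchInfo z p}) ≠ 0 :=
    fun h => hp (measure_mono_null (by simp) h)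
  rw [matchPosterior, condExp_indicator_comap_apply _ (measurable_matchInfo z) MeasurableSet.of_discrete hfib,
    measureReal_cond_apply MeasurableSet.of_discrete, winProb,
    ← cond_cond_eq_cond_inter MeasurableSet.of_discrete MeasurableSet.of_discrete,
    measureReal_cond_apply (P := μ[|E]) MeasurableSet.of_discrete]
  have h1 : matchInfo z ⁻¹' {matchInfo z p}
      = {q | q.1 ∈ (Set.univ : Set Game) ∧ matchInfo z q = matchInfo z (p.1, p.2)} := by
    ext q
    simp
  have h2 : matchInfo z ⁻¹' {matchInfo z p} ∩ {q | q.1.value x = 1}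
      = {q | q.1 ∈ {g : Game | g.value x = 1} ∧ matchInfo z q = matchInfo z (p.1, p.2)} := by
    ext q
    simp [and_comm]
  rw [h2, h1, measureReal_def, measureReal_def, matchLaw,
    compProd_matchInfo _ (ae_mem_tree hz) hpl hpz, compProd_matchInfo _ (ae_mem_tree hz) hpl hpz,
    Set.univ_inter, ENNReal.toReal_mul, ENNReal.toReal_mul, Set.inter_comm {g : Game | _},
    ← measureReal_def, ← measureReal_def]
  have hu : (uniformMatch p.1.tree z p.2).toReal ≠ 0 :=
    ENNReal.toReal_ne_zero.2 ⟨uniformMatch_ne_zero p.1.isTree hpz hpl, PMF.apply_ne_top _ _⟩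
  field_simp

theorem memLp_winIndicator (Q : Measure (Game × Word)) [IsFiniteMeasure Q] (x : Word) :
    MemLp (winIndicator x) 2 Q :=
  memLp_indicator_const 2 MeasurableSet.of_discrete 1 (Or.inr (measure_ne_top _ _))

theorem memLp_matchPosterior (Q : Measure (Game × Word)) [IsFiniteMeasure Q] (z x : Word) :
    MemLp (matchPosterior Q z x) 2 Q :=
  (memLp_winIndicator Q x).condExp one_le_two

theorem integral_matchPosterior (μ : Measure Game) [IsFiniteMeasure μ] {E : Set Game}
    (hE : μ E ≠ 0) (z x : Word) :
    ∫ p, matchPosterior (matchLaw μ E z) z x p ∂(matchLaw μ E z) = winProb μ E x := by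
  have := cond_isProbabilityMeasure hE
  rw [matchPosterior, integral_condExp (measurable_matchInfo z).comap_le, winIndicator,
    integral_indicator_const _ MeasurableSet.of_discrete, smul_eq_mul, mul_one, winProb,
    measureReal_def, measureReal_def]
  congr 1
  have : ({p | p.1.value x = 1} : Set (Game × Word)) = Prod.fst ⁻¹' {g | g.value x = 1} := rfl
  rw [this, ← Measure.fst_apply MeasurableSet.of_discrete, Measure.fst_compProd]

/-- `s(T, z)` is the variance of the posterior winning probability at `z`. -/
theorem meanInformation_eq_variance {μ : Measure Game} [IsProbabilityMeasure μ] {g₀ : Game}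
    {z : Word} (hz : z ∈ g₀.tree) (hpos : μ (explored g₀ z) ≠ 0) :
    meanInformation μ (kin g₀.tree z) z
      = Var[matchPosterior (matchLaw μ (explored g₀ z) z) z z; matchLaw μ (explored g₀ z) z] := by
  have := cond_isProbabilityMeasure hpos
  rw [variance_eq_integral (memLp_matchPosterior _ _ _).aemeasurable,
    integral_matchPosterior _ hpos]
  simp only [meanInformation, exploredEvent_kin g₀ hz, meanValue]
  rw [cond_compProd]
  refine integral_congr_ae ?_
  filter_upwards [ae_singleton_ne_zero (matchLaw μ (explored g₀ z) z)] with p hp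
  have hpA : p ∈ Prod.fst ⁻¹' explored g₀ z :=
    (matchLaw_support (fun g hg => hg.1) hp).1
  refine congrArg (fun t => (t - winProb μ (explored g₀ z) z) ^ 2) ?_
  have hfib : matchLaw μ (explored g₀ z) z (matchInfo z ⁻¹' {matchInfo z p}) ≠ 0 :=
    fun h => hp (measure_mono_null (by simp) h)
  rw [matchPosterior, condExp_indicator_comap_apply _ (measurable_matchInfo z) MeasurableSet.of_discrete hfib]
  rw [matchLaw, ← cond_compProd] at hfib ⊢
  rw [cond_cond_eq_cond_inter MeasurableSet.of_discrete MeasurableSet.of_discrete]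
  rw [MeasurableSpace.generateFrom_singleton, ← MeasurableSpace.comap_prodMk]
  have hset : (fun q : Game × Word => (matchInfo z q, q ∈ Prod.fst ⁻¹' explored g₀ z)) ⁻¹'
      {(matchInfo z p, p ∈ Prod.fst ⁻¹' explored g₀ z)}
      = Prod.fst ⁻¹' explored g₀ z ∩ matchInfo z ⁻¹' {matchInfo z p} := by
    ext q
    simp only [Set.mem_preimage, Set.mem_singleton_iff, Prod.mk.injEq, Set.mem_inter_iff]
    rw [and_comm]
    refine and_congr_left fun _ => ?_
    simp only [Set.mem_preimage] at hpA
    simp [hpA]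
  rw [← hset]
  refine condExp_indicator_comap_apply (ι := (Word × Finset Word × Bool) × Prop) _ Measurable.of_discrete
    MeasurableSet.of_discrete ?_
  rw [hset]
  intro h
  refine hfib ?_
  rw [cond_apply MeasurableSet.of_discrete, h, mul_zero]

/-- The variance of the posterior winning probability at `z` only depends on the law of the subgame
issued from `z`. -/
theorem variance_matchPosterior_congr {μ : Measure Game} [IsProbabilityMeasure μ] {E E' : Set Game}
    {z : Word} (hz : ∀ g ∈ E, z ∈ g.tree) (hz' : ∀ g ∈ E', z ∈ g.tree)
    (hE : μ E ≠ 0) (hE' : μ E' ≠ 0)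
    (hlaw : ∀ F, DeterminedAt z F → (μ[|E]) F = (μ[|E']) F) :
    Var[matchPosterior (matchLaw μ E z) z z; matchLaw μ E z]
      = Var[matchPosterior (matchLaw μ E' z) z z; matchLaw μ E' z] := by
  have := cond_isProbabilityMeasure hE
  have := cond_isProbabilityMeasure hE'
  have hQ : ∀ (B : Set Game), DeterminedAt z B → ∀ i,
      matchLaw μ E z {p | p.1 ∈ B ∧ matchInfo z p = i}
        = matchLaw μ E' z {p | p.1 ∈ B ∧ matchInfo z p = i} := by
    intro B hB i
    by_cases hi : ∃ p : Game × Word, p.2 ∈ leaves p.1.tree ∧ z <+: p.2 ∧ matchInfo z p = i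
    · obtain ⟨⟨g, y⟩, hy, hzy, rfl⟩ := hi
      rw [matchLaw, matchLaw, compProd_matchInfo _ (ae_mem_tree hz) hy hzy,
        compProd_matchInfo _ (ae_mem_tree hz') hy hzy,
        hlaw _ (hB.inter (determinedAt_matchEvent hzy g))]
    · have hnull : ∀ E : Set Game, (∀ g ∈ E, z ∈ g.tree) →
          matchLaw μ E z {p | p.1 ∈ B ∧ matchInfo z p = i} = 0 := by
        intro E hz
        rw [measure_null_iff_singleton (Set.to_countable _)]
        intro p hp
        by_contra h
        obtain ⟨-, -, h1, h2⟩ := matchLaw_support hz h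
        exact hi ⟨p, h1, h2, hp.2⟩
      rw [hnull E hz, hnull E' hz']
  have hfib : ∀ i, matchLaw μ E z (matchInfo z ⁻¹' {i}) = matchLaw μ E' z (matchInfo z ⁻¹' {i}) := by
    intro i
    have := hQ Set.univ (determinedAt_univ z) i
    simpa [Set.preimage] using this
  have hmap : (matchLaw μ E z).map (matchInfo z) = (matchLaw μ E' z).map (matchInfo z) := by
    refine Measure.ext_of_singleton fun i => ?_
    rw [Measure.map_apply (measurable_matchInfo z) (measurableSet_singleton _),
      Measure.map_apply (measurable_matchInfo z) (measurableSet_singleton _), hfib]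
  let φ : Word × Finset Word × Bool → ℝ := fun i =>
    ((matchLaw μ E z)[|matchInfo z ⁻¹' {i}]).real {p | p.1.value z = 1}
  have hφ : ∀ i, ((matchLaw μ E' z)[|matchInfo z ⁻¹' {i}]).real {p | p.1.value z = 1} = φ i := by
    intro i
    have h := hQ _ (determinedAt_value z) i
    have hs : {p : Game × Word | p.1 ∈ {g : Game | g.value z = 1} ∧ matchInfo z p = i}
        = matchInfo z ⁻¹' {i} ∩ {p | p.1.value z = 1} := by
      ext p
      simp [and_comm]
    rw [hs] at h
    dsimp only [φ]
    rw [measureReal_cond_apply MeasurableSet.of_discrete,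
      measureReal_cond_apply MeasurableSet.of_discrete, measureReal_def, measureReal_def,
      measureReal_def, measureReal_def, hfib, h]
  have hvar : ∀ E : Set Game, μ E ≠ 0 →
      (∀ i, ((matchLaw μ E z)[|matchInfo z ⁻¹' {i}]).real {p | p.1.value z = 1} = φ i) →
      Var[matchPosterior (matchLaw μ E z) z z; matchLaw μ E z]
        = Var[φ; (matchLaw μ E z).map (matchInfo z)] := by
    intro E hE h
    have := cond_isProbabilityMeasure hE
    rw [variance_map Measurable.of_discrete.aemeasurable Measurable.of_discrete.aemeasurable]
    refine variance_congr ?_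
    filter_upwards [ae_preimage_singleton_ne_zero (matchLaw μ E z) (matchInfo z)] with p hp
    rw [matchPosterior, condExp_indicator_comap_apply _ (measurable_matchInfo z) MeasurableSet.of_discrete hp,
      h]
    rfl
  rw [hvar E hE fun _ => rfl, hvar E' hE' hφ, hmap]

/-- After a match from `z`, the mean square error on the value of the root is reduced by the
information provided by the match on the value of `z`, multiplied by the square of the product of
the weights along the branch from the root to `z`. -/
theorem integral_sq_error {μ : Measure Game} [IsProbabilityMeasure μ] (hb : BranchingProperty μ)
    {g₀ : Game} {xs : Finset Word} {z : Word} (h₀ : xs ⊆ leaves g₀.tree)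
    (hz : z ∈ boundary g₀.tree xs) (hpos : μ (consistent g₀ xs) ≠ 0) :
    ∫ p, (matchPosterior (matchLaw μ (consistent g₀ xs) z) z [] p - winIndicator [] p) ^ 2
        ∂(matchLaw μ (consistent g₀ xs) z)
      = Var[({g | g.value [] = 1} : Set Game).indicator (fun _ => (1 : ℝ)); μ[|consistent g₀ xs]]
        - pathWeight g₀.tree (winProb μ (consistent g₀ xs)) z ^ 2
          * meanInformation μ (kin g₀.tree z) z := by
  have := cond_isProbabilityMeasure hpos
  have hzT : z ∈ g₀.tree := (mem_boundary_iff.1 hz).1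
  have hxs := fun v => strictPrefix_of_mem_boundary (v := v) hz
  have hsub := consistent_subset_explored hzT hxs
  have hzE : ∀ g ∈ consistent g₀ xs, z ∈ g.tree := fun g hg => (hsub hg).1
  have hpos' : μ (explored g₀ z) ≠ 0 := fun h => hpos (measure_mono_null hsub h)
  rw [meanInformation_eq_variance hzT hpos', ← variance_matchPosterior_congr hzE (fun g hg => hg.1)
    hpos hpos' (fun F hF => cond_consistent_apply hb h₀ hz hpos hF)]
  obtain ⟨a, ha⟩ := exists_winProb_root hzT (fun v hv => indepAt_consistent hb h₀
    (g₀.isTree.mem_of_prefix hzT hv) (fun u hu => hxs u (hu.trans_prefix hv)) hpos)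
  have hvar : Var[matchPosterior (matchLaw μ (consistent g₀ xs) z) z [];
      matchLaw μ (consistent g₀ xs) z]
      = pathWeight g₀.tree (winProb μ (consistent g₀ xs)) z ^ 2
        * Var[matchPosterior (matchLaw μ (consistent g₀ xs) z) z z;
          matchLaw μ (consistent g₀ xs) z] := by
    rw [← variance_const_mul, ← variance_const_add
      ((memLp_matchPosterior _ _ _).aestronglyMeasurable.const_mul _) a]
    refine variance_congr ?_
    filter_upwards [ae_singleton_ne_zero (matchLaw μ (consistent g₀ xs) z)] with p hp
    obtain ⟨h1, h2⟩ := matchPosterior_apply hzE [] hp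
    rw [h2, (matchPosterior_apply hzE z hp).2,
      ha _ (determinedAt_matchEvent (matchLaw_support hzE hp).2.2.2 _) h1]
  have htot := integral_condVar_add_variance_condExp
    (measurable_matchInfo z).comap_le (memLp_winIndicator (matchLaw μ (consistent g₀ xs) z) [])
  have hcv : ∫ p, (Var[winIndicator []; matchLaw μ (consistent g₀ xs) z |
      MeasurableSpace.comap (matchInfo z) inferInstance]) p ∂(matchLaw μ (consistent g₀ xs) z)
      = ∫ p, (matchPosterior (matchLaw μ (consistent g₀ xs) z) z [] p - winIndicator [] p) ^ 2
        ∂(matchLaw μ (consistent g₀ xs) z) := by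
    rw [condVar, integral_condExp (measurable_matchInfo z).comap_le]
    refine integral_congr_ae (Filter.Eventually.of_forall fun p => ?_)
    simp only [Pi.pow_apply, Pi.sub_apply]
    ring
  have hfst : Var[winIndicator []; matchLaw μ (consistent g₀ xs) z]
      = Var[({g | g.value [] = 1} : Set Game).indicator (fun _ => (1 : ℝ));
        μ[|consistent g₀ xs]] := by
    rw [← Measure.fst_compProd (μ[|consistent g₀ xs]) (matchKernel z), Measure.fst,
      variance_map Measurable.of_discrete.aemeasurable Measurable.of_discrete.aemeasurable]
    rfl
  rw [hcv, hfst] at htot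
  rw [← hvar]
  linarith

/-! ### A match from an uncertain node is informative -/

theorem explored_subset_of_prefix {g₀ : Game} {z u : Word} (h : z <+: u) :
    explored g₀ u ⊆ explored g₀ z :=
  fun g hg => ⟨g.isTree.mem_of_prefix hg.1 h, fun v hv => hg.2 v (hv.trans_prefix h)⟩

theorem explored_snoc {g₀ : Game} {u : Word} {k : ℕ+} (hk : u ++ [k] ∈ g₀.tree) :
    explored g₀ (u ++ [k]) = explored g₀ u ∩ {g | children g.tree u = children g₀.tree u} := by
  have hs : StrictPrefix u (u ++ [k]) := strictPrefix_snoc_iff.2 List.prefix_rfl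
  ext g
  constructor
  · exact fun hg => ⟨explored_subset_of_prefix hs.1 hg, hg.2 u hs⟩
  · rintro ⟨hg, hc⟩
    refine ⟨snoc_mem_children.1 (hc ▸ snoc_mem_children.2 hk), fun v hv => ?_⟩
    by_cases e : v = u
    · rw [e]
      exact hc
    · exact hg.2 v ⟨strictPrefix_snoc_iff.1 hv, e⟩

/-- The value of a visited leaf is known. -/
theorem winProb_visited {μ : Measure Game} [IsFiniteMeasure μ] {g₀ : Game} {xs : Finset Word}
    {x : Word} (h₀ : xs ⊆ leaves g₀.tree) (hx : x ∈ xs) (hpos : μ (consistent g₀ xs) ≠ 0) :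
    winProb μ (consistent g₀ xs) x = 0 ∨ winProb μ (consistent g₀ xs) x = 1 := by
  have hval : ∀ g ∈ consistent g₀ xs, (g.value x = 1 ↔ g₀.value x = 1) := by
    intro g hg
    rw [Game.value_eq_one_iff, Game.value_eq_one_iff, Game.firstWinsFrom_leaf (h₀ hx),
      Game.firstWinsFrom_leaf (hg.1 hx)]
    exact hg.2.2 x hx
  have := cond_isProbabilityMeasure hpos
  have hae := ae_cond_mem (μ := μ) (MeasurableSet.of_discrete (s := consistent g₀ xs))
  by_cases hv : g₀.value x = 1
  · right
    rw [winProb, measureReal_def, (mem_ae_iff_prob_eq_one MeasurableSet.of_discrete).1,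
      ENNReal.toReal_one]
    filter_upwards [hae] with g hg
    exact (hval g hg).2 hv
  · left
    rw [winProb, measureReal_eq_zero_iff]
    refine measure_eq_zero_iff_ae_notMem.2 ?_
    filter_upwards [hae] with g hg
    exact fun h' => hv ((hval g hg).1 h')

/-- If all the information that a match from `z` may provide leaves the winning probability at `z`
equal to `m`, then so does the knowledge of the environment of any descendant `u` of `z`. -/
theorem winProb_explored_eq {μ : Measure Game} [IsProbabilityMeasure μ] {g₀ : Game} {z : Word}
    {m : ℝ} (h : ∀ g ∈ explored g₀ z, μ {g} ≠ 0 → ∀ y ∈ leaves g.tree, z <+: y →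
      winProb μ (consistent g {y}) z = m)
    {u : Word} (hzu : z <+: u) (hpos : μ (explored g₀ u) ≠ 0) :
    winProb μ (explored g₀ u) z = m := by
  have := cond_isProbabilityMeasure hpos
  rw [← integral_matchPosterior μ hpos u z]
  have hae : matchPosterior (matchLaw μ (explored g₀ u) u) u z
      =ᵐ[matchLaw μ (explored g₀ u) u] fun _ => m := by
    filter_upwards [ae_singleton_ne_zero (matchLaw μ (explored g₀ u) u)] with p hp
    obtain ⟨h1, h2, h3, h4⟩ := matchLaw_support (fun g hg => hg.1) hp
    rw [(matchPosterior_apply (fun g hg => hg.1) z hp).2, explored_inter_matchEvent h1 h4]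
    exact h _ (explored_subset_of_prefix hzu h1) h2 _ h3 (hzu.trans h4)
  rw [integral_congr_ae hae]
  simp

/-- The descent which proves `winProb_certain_of_meanInformation_eq_zero`: the value of `z`
depends on that of its descendant `u`, which is uncertain, while no match changes the winning
probability at `z`. Some child of `u` has then the same properties, until a leaf is reached. -/
theorem false_of_uncertain_descendant {μ : Measure Game} [IsProbabilityMeasure μ]
    (hb : BranchingProperty μ) {g₀ : Game} {z : Word} (hg₀ : μ {g₀} ≠ 0) {m : ℝ}
    (h : ∀ g ∈ explored g₀ z, μ {g} ≠ 0 → ∀ y ∈ leaves g.tree, z <+: y →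
      winProb μ (consistent g {y}) z = m)
    {u : Word} (hu : u ∈ g₀.tree) (hzu : z <+: u) {a σ : ℝ} (hσ : σ ≠ 0)
    (haff : ∀ F, DeterminedAt u F → μ (explored g₀ u ∩ F) ≠ 0 →
      winProb μ (explored g₀ u ∩ F) z = a + σ * winProb μ (explored g₀ u ∩ F) u)
    (h0 : 0 < winProb μ (explored g₀ u) u) (h1 : winProb μ (explored g₀ u) u < 1) : False := by
  induction hn : g₀.tree.sup List.length + 1 - u.length using Nat.strong_induction_on
    generalizing u a σ with
  | _ n ih =>
    have hne : ∀ {A : Set Game}, g₀ ∈ A → μ A ≠ 0 := fun hA hμ =>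
      hg₀ (measure_mono_null (by simpa using hA) hμ)
    have hm : m = a + σ * winProb μ (explored g₀ u) u := by
      have := haff Set.univ (determinedAt_univ u)
      rw [Set.inter_univ, winProb_explored_eq h hzu (hne (self_mem_explored hu))] at this
      exact this (hne (self_mem_explored hu))
    by_cases hl : u ∈ leaves g₀.tree
    · have hcons := explored_inter_matchEvent (self_mem_explored hu) (List.prefix_rfl (l := u))
      have hself : g₀ ∈ consistent g₀ {u} := self_mem_consistent (by simpa using hl)
      have hleaf := haff _ (determinedAt_matchEvent List.prefix_rfl g₀)
      rw [hcons] at hleaf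
      have hleaf := hleaf (hne hself)
      rw [h g₀ (explored_subset_of_prefix hzu (self_mem_explored hu)) hg₀ u hl hzu, hm] at hleaf
      have heq : winProb μ (explored g₀ u) u = winProb μ (consistent g₀ {u}) u :=
        mul_left_cancel₀ hσ (add_left_cancel hleaf)
      rcases winProb_visited (by simpa using hl) (Finset.mem_singleton_self u) (hne hself) with hv | hv
      · linarith
      · linarith
    · obtain ⟨c₀, hc₀⟩ : (children g₀.tree u).Nonempty := by
        rw [Finset.nonempty_iff_ne_empty]
        exact fun e => hl (g₀.isTree.mem_leaves_iff_children.2 ⟨hu, e⟩)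
      obtain ⟨hk, k, rfl⟩ := mem_children.1 hc₀
      have hchild : DeterminedAt u {g | children g.tree u = children g₀.tree u} := by
        intro g g' e hg
        exact (children_eq_of_subgame_eq e List.prefix_rfl).symm.trans hg
      have hposk := hne (self_mem_explored hk)
      have huk : u <+: u ++ [k] := List.prefix_append _ _
      have heq : winProb μ (explored g₀ (u ++ [k])) u = winProb μ (explored g₀ u) u := by
        have := haff _ hchild
        rw [← explored_snoc hk] at this
        have := this hposk
        rw [winProb_explored_eq h (hzu.trans huk) hposk, hm] at this
        exact (mul_left_cancel₀ hσ (add_left_cancel this)).symm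
      obtain ⟨c, hc, hw, hc0, hc1⟩ := (indepAt_explored hb hk hposk).exists_child_uncertain hk hposk
        (by rwa [heq]) (by rwa [heq])
      have hlt := length_lt_of_mem_children hc
      obtain ⟨hj, j, rfl⟩ := mem_children.1 hc
      have hsame : explored g₀ (u ++ [k]) = explored g₀ (u ++ [j]) := by
        rw [explored_snoc hk, explored_snoc hj]
      rw [hsame] at hw hc0 hc1
      have huj : u <+: u ++ [j] := List.prefix_append _ _
      obtain ⟨b, hb'⟩ := (indepAt_explored hb hj (hne (self_mem_explored hj))).exists_winProb_step hj
      refine ih _ (hn ▸ hlt) hj (hzu.trans huj) (mul_ne_zero hσ hw) (a := a + σ * b)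
        (fun F hF hpos => ?_) hc0 hc1 rfl
      have h2 := haff _ (hchild.inter (hF.of_prefix huj))
      rw [← Set.inter_assoc, ← explored_snoc hj] at h2
      rw [h2 hpos, hb' F hF hpos]
      ring

/-- If a match from `z` brings no information on the value of `z`, then this value is known. -/
theorem winProb_certain_of_meanInformation_eq_zero {μ : Measure Game} [IsProbabilityMeasure μ]
    (hb : BranchingProperty μ) {g₀ : Game} {z : Word} (hg₀ : μ {g₀} ≠ 0) (hz : z ∈ g₀.tree)
    (hs : meanInformation μ (kin g₀.tree z) z = 0) :
    ¬ (0 < winProb μ (explored g₀ z) z ∧ winProb μ (explored g₀ z) z < 1) := by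
  rintro ⟨h0, h1⟩
  have hpos : μ (explored g₀ z) ≠ 0 := fun h =>
    hg₀ (measure_mono_null (by simpa using self_mem_explored hz) h)
  have := cond_isProbabilityMeasure hpos
  rw [meanInformation_eq_variance hz hpos] at hs
  have hae := ae_eq_integral_of_variance_eq_zero (memLp_matchPosterior _ _ _) hs
  rw [integral_matchPosterior μ hpos, ae_iff_of_countable] at hae
  refine false_of_uncertain_descendant hb hg₀ (m := winProb μ (explored g₀ z) z) ?_ hz
    List.prefix_rfl (a := 0) one_ne_zero (fun F _ _ => by ring) h0 h1
  intro g hg hgμ y hy hzy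
  have hp := matchLaw_singleton_ne_zero (p := (g, y)) hg hgμ hy hzy
  rw [← hae _ hp, (matchPosterior_apply (fun g hg => hg.1) z hp).2,
    explored_inter_matchEvent hg hzy]

/-! ### The law of the game given what the matches reveal -/

/-- The random set of visited leaves `vis` brings no other information on the game than the
corresponding observation: the likelihood of `vis = xs` is the same for all the games which give the
same observation. -/
structure Neutral {Ω : Type*} [MeasurableSpace Ω] (P : Measure Ω) (game : Ω → Game)
    (vis : Ω → Finset Word) : Prop where
  measurable_vis : Measurable vis
  subset_leaves : ∀ g xs, P {ω | game ω = g ∧ vis ω = xs} ≠ 0 → xs ⊆ leaves g.tree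
  likelihood : ∀ g g' xs, xs ⊆ leaves g.tree → g' ∈ consistent g xs →
    P.map game {g'} * P {ω | game ω = g ∧ vis ω = xs}
      = P.map game {g} * P {ω | game ω = g' ∧ vis ω = xs}

theorem visited_succ {Ω : Type*} (x : ℕ → Ω → Word) (k : ℕ) (ω : Ω) :
    visited x (k + 1) ω = insert (x (k + 1) ω) (visited x k ω) := by
  rw [visited, ← Finset.insert_Icc_right_eq_Icc_add_one (by omega), Finset.image_insert, visited]

theorem measurable_game_past {Ω : Type*} {game : Ω → Game} {X : ℕ → Ω → unitInterval}
    {x : ℕ → Ω → Word} (k : ℕ) : Measurable[past game X x k] game :=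
  Measurable.of_comap_le (le_sup_of_le_left le_sup_left)

theorem measurable_visited {Ω : Type*} {m : MeasurableSpace Ω} {x : ℕ → Ω → Word} {n : ℕ}
    (hx : ∀ k ∈ Set.Icc 1 n, Measurable[m] (x k)) : Measurable[m] (visited x n) := by
  induction n with
  | zero =>
    have : visited x 0 = fun _ => ∅ := rfl
    rw [this]
    exact measurable_const
  | succ k ih =>
    have : visited x (k + 1)
        = (fun q : Word × Finset Word => insert q.1 q.2) ∘ fun ω => (x (k + 1) ω, visited x k ω) :=
      funext fun ω => visited_succ x k ω
    rw [this]
    exact Measurable.of_discrete.comp ((hx (k + 1) (by simp)).prodMk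
      (ih fun i hi => hx i ⟨hi.1, hi.2.trans (Nat.le_succ k)⟩))

theorem measurable_visited_past {Ω : Type*} {game : Ω → Game} {X : ℕ → Ω → unitInterval}
    {x : ℕ → Ω → Word} (k : ℕ) : Measurable[past game X x k] (visited x k) :=
  measurable_visited fun i hi =>
    Measurable.of_comap_le (le_sup_of_le_right (le_iSup₂_of_le i hi le_rfl))

theorem measurableSet_game_visited_past {Ω : Type*} {game : Ω → Game} {X : ℕ → Ω → unitInterval}
    {x : ℕ → Ω → Word} (k : ℕ) (g : Game) (xs : Finset Word) :
    MeasurableSet[past game X x k] {ω | game ω = g ∧ visited x k ω = xs} :=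
  MeasurableSet.inter (measurable_game_past k (measurableSet_singleton g))
    (measurable_visited_past k (measurableSet_singleton xs))

/-- The event that the observation is the same as at `ω₀`. -/
def sameObservation {Ω : Type*} (game : Ω → Game) (vis : Ω → Finset Word) (ω₀ : Ω) : Set Ω :=
  (fun ω => observe (game ω) (vis ω)) ⁻¹' {observe (game ω₀) (vis ω₀)}

theorem vis_eq_of_mem_sameObservation {Ω : Type*} {game : Ω → Game} {vis : Ω → Finset Word}
    {ω ω₀ : Ω} (h : ω ∈ sameObservation game vis ω₀) :
    vis ω = vis ω₀ :=
  congrArg Observation.visited h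

section Matches

variable {Ω : Type*} {𝓗 : MeasurableSpace Ω} [mΩ : MeasurableSpace Ω] {P : Measure Ω} {game : Ω → Game}

theorem mem_matchEvent_of_mem_consistent {g g' : Game} {xs : Finset Word} {v : Word} (hv : v ∈ xs)
    (h : g' ∈ consistent g xs) (z : Word) : g' ∈ matchEvent z g v :=
  ⟨h.1 hv, fun u _ hu => h.2.1 v hv u hu, h.2.2 v hv⟩

theorem measure_eq_tsum_inter {κ : Type*} [Countable κ] [MeasurableSpace κ]
    [MeasurableSingletonClass κ] {Y : Ω → κ} (hY : Measurable Y) {S : Set Ω}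
    (hS : MeasurableSet S) : P S = ∑' k, P (S ∩ Y ⁻¹' {k}) := by
  rw [← measure_iUnion]
  · congr 1
    ext ω
    simp
  · intro i j hij
    refine Set.disjoint_left.2 fun ω hi hj => hij ?_
    exact hi.2.symm.trans hj.2
  · exact fun k => hS.inter (hY (measurableSet_singleton k))

theorem measurableSet_game_vis (hgame : Measurable game) {vis : Ω → Finset Word}
    (hvis : Measurable vis) (g : Game) (xs : Finset Word) :
    MeasurableSet {ω | game ω = g ∧ vis ω = xs} :=
  (hgame (measurableSet_singleton g)).inter (hvis (measurableSet_singleton xs))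

theorem neutral_empty (hgame : Measurable game) : Neutral P game (fun _ => ∅) := by
  refine ⟨measurable_const, fun g xs h => ?_, fun g g' xs _ _ => ?_⟩
  · obtain rfl : ∅ = xs := by
      by_contra e
      simp [e] at h
    exact Finset.empty_subset _
  · by_cases e : ∅ = xs
    · rw [Measure.map_apply hgame (measurableSet_singleton _),
        Measure.map_apply hgame (measurableSet_singleton _), mul_comm]
      simp [e, Set.preimage]
    · simp [e]

/-- Neutrality is preserved when `vis` is updated by means of a random variable `A`, whose law
knowing the game `g` and `vis` is the same for all the games which give the same observation after
the update. -/
theorem Neutral.step (hgame : Measurable game) {vis vis' : Ω → Finset Word}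
    (hvis : Neutral P game vis) (hvis'm : Measurable vis')
    {ι : Type*} [Countable ι] [MeasurableSpace ι] [MeasurableSingletonClass ι]
    {A : Ω → ι} (hA : Measurable A) (Φ : Finset Word → ι → Finset Word)
    (hvis' : ∀ᵐ ω ∂P, vis' ω = Φ (vis ω) (A ω)) (τ : Game → Finset Word → ι → ENNReal)
    (hτ : ∀ g xs a, P ({ω | game ω = g ∧ vis ω = xs} ∩ A ⁻¹' {a})
      = P {ω | game ω = g ∧ vis ω = xs} * τ g xs a)
    (hsub : ∀ g xs a, P {ω | game ω = g ∧ vis ω = xs} ≠ 0 → xs ⊆ leaves g.tree → τ g xs a ≠ 0 →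
      xs ⊆ Φ xs a ∧ Φ xs a ⊆ leaves g.tree)
    (hcongr : ∀ g g' xs a, xs ⊆ Φ xs a → Φ xs a ⊆ leaves g.tree → g' ∈ consistent g (Φ xs a) →
      τ g xs a = τ g' xs a) : Neutral P game vis' := by
  have hsum : ∀ g xs', P {ω | game ω = g ∧ vis' ω = xs'}
      = ∑' q : Finset Word × ι, if Φ q.1 q.2 = xs' then
        P {ω | game ω = g ∧ vis ω = q.1} * τ g q.1 q.2 else 0 := by
    intro g xs'
    rw [measure_eq_tsum_inter (hvis.measurable_vis.prodMk hA)
      (measurableSet_game_vis hgame hvis'm g xs')]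
    refine tsum_congr fun q => ?_
    have hae : ({ω | game ω = g ∧ vis' ω = xs'} ∩ (fun ω => (vis ω, A ω)) ⁻¹' {q} : Set Ω) =ᵐ[P]
        (if Φ q.1 q.2 = xs' then {ω | game ω = g ∧ vis ω = q.1} ∩ A ⁻¹' {q.2} else ∅ : Set Ω) := by
      filter_upwards [hvis'] with ω hω
      refine propext ?_
      change (game ω = g ∧ vis' ω = xs') ∧ (vis ω, A ω) = q ↔ ω ∈ (if Φ q.1 q.2 = xs' then
        {ω | game ω = g ∧ vis ω = q.1} ∩ A ⁻¹' {q.2} else ∅ : Set Ω)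
      rw [hω]
      split_ifs with e
      · constructor
        · rintro ⟨⟨h1, h2⟩, rfl⟩
          exact ⟨⟨h1, rfl⟩, rfl⟩
        · rintro ⟨⟨h1, h2⟩, h3⟩
          have h3 : A ω = q.2 := h3
          refine ⟨⟨h1, ?_⟩, Prod.ext h2 h3⟩
          rw [h2, h3, e]
      · simp only [Set.mem_empty_iff_false, iff_false]
        rintro ⟨⟨h1, h2⟩, rfl⟩
        exact e h2
    rw [measure_congr hae]
    split_ifs
    · exact hτ g q.1 q.2
    · exact measure_empty
  have hmem : ∀ g xs a, P {ω | game ω = g ∧ vis ω = xs} * τ g xs a ≠ 0 →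
      xs ⊆ Φ xs a ∧ Φ xs a ⊆ leaves g.tree := fun g xs a h =>
    hsub g xs a (left_ne_zero_of_mul h) (hvis.subset_leaves g xs (left_ne_zero_of_mul h))
      (right_ne_zero_of_mul h)
  refine ⟨hvis'm, fun g xs' h => ?_, fun g g' xs' hl hg' => ?_⟩
  · rw [hsum, Ne, ENNReal.tsum_eq_zero, not_forall] at h
    obtain ⟨q, hq⟩ := h
    split_ifs at hq with e
    · exact e ▸ (hmem g q.1 q.2 hq).2
    · exact absurd rfl hq
  · rw [hsum, hsum, ← ENNReal.tsum_mul_left, ← ENNReal.tsum_mul_left]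
    refine tsum_congr fun q => ?_
    split_ifs with e
    · by_cases hq : q.1 ⊆ Φ q.1 q.2
      · rw [← e] at hl hg'
        rw [← mul_assoc, ← mul_assoc, hcongr g g' _ _ hq hl hg',
          hvis.likelihood g g' q.1 (hq.trans hl) (consistent_mono hq hg')]
      · rw [not_not.1 (mt (hmem g q.1 q.2) fun h => hq h.1),
          not_not.1 (mt (hmem g' q.1 q.2) fun h => hq h.1), mul_zero, mul_zero]
    · rw [mul_zero, mul_zero]

theorem IsUniformMatchOn.measure_inter [IsFiniteMeasure P]
    (h𝓗 : 𝓗 ≤ mΩ) {E : Set Ω} {z y : Ω → Word}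
    (h : IsUniformMatchOn P game 𝓗 E z y) (hy : Measurable y) {B : Set Ω}
    (hB : MeasurableSet[𝓗] B) (hBE : B ⊆ E) {g : Game} {z₀ : Word}
    (hg : ∀ ω ∈ B, game ω = g ∧ z ω = z₀) (v : Word) :
    P (B ∩ y ⁻¹' {v}) = P B * uniformMatch g.tree z₀ v := by
  have hv : MeasurableSet {ω | y ω = v} := hy (measurableSet_singleton v)
  have hint : Integrable (({ω | y ω = v} : Set Ω).indicator fun _ => (1 : ℝ)) P :=
    (integrable_const 1).indicator hv
  have h1 := setIntegral_condExp h𝓗 hint hB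
  have h2 : ∫ ω in B, (P[({ω | y ω = v} : Set Ω).indicator (fun _ => (1 : ℝ)) | 𝓗]) ω ∂P
      = ∫ _ in B, (uniformMatch g.tree z₀ v).toReal ∂P := by
    refine setIntegral_congr_ae (h𝓗 _ hB) ?_
    filter_upwards [h v] with ω hω hωB
    rw [hω (hBE hωB), (hg ω hωB).1, (hg ω hωB).2]
  rw [h2, setIntegral_const, smul_eq_mul, setIntegral_indicator hv, setIntegral_const, smul_eq_mul,
    mul_one, measureReal_def, measureReal_def, ← ENNReal.toReal_mul] at h1
  exact ((ENNReal.toReal_eq_toReal_iff' (ENNReal.mul_ne_top (measure_ne_top _ _)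
    (PMF.apply_ne_top _ _)) (measure_ne_top _ _)).1 h1).symm

theorem observe_isPossible {g : Game} {xs : Finset Word} (hxs : xs ⊆ leaves g.tree)
    (hne : xs.Nonempty) : (observe g xs).IsPossible := by
  refine ⟨⟨branches xs, ⟨?_, ?_⟩, ?_⟩, ?_, Finset.inter_subset_left⟩
  · obtain ⟨x, hx⟩ := hne
    exact mem_branches.2 ⟨x, hx, List.nil_prefix⟩
  · intro u hu v hv
    obtain ⟨x, hx, hux⟩ := mem_branches.1 hu
    exact mem_branches.2 ⟨x, hx, (mem_branch.1 hv).trans hux⟩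
  · ext w
    rw [mem_leaves]
    constructor
    · intro hw
      refine ⟨mem_branches.2 ⟨w, hw, List.prefix_rfl⟩, fun y hy hwy => ?_⟩
      obtain ⟨x, hx, hyx⟩ := mem_branches.1 hy
      exact (mem_leaves.1 (hxs hw)).2 x (mem_of_mem_leaves (hxs hx)) (hwy.trans_prefix hyx)
    · rintro ⟨hw, h⟩
      obtain ⟨x, hx, hwx⟩ := mem_branches.1 hw
      by_cases e : w = x
      · exact e ▸ hx
      · exact absurd ⟨hwx, e⟩ (h x (mem_branches.2 ⟨x, hx, List.prefix_rfl⟩))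
  · intro y hy
    simp only [observe, boundary, Finset.coe_filter] at hy
    exact hy.2

section Simulation

variable {F : SelectionRule} {X : ℕ → Ω → unitInterval} {x : ℕ → Ω → Word} {n : ℕ}

theorem IsSimulation.past_le (hsim : IsSimulation P game F X x n) {k : ℕ} (hk : k ≤ n) :
    past game X x k ≤ mΩ := by
  refine sup_le (sup_le hsim.measurable_game.comap_le (iSup₂_le fun i hi => ?_))
    (iSup₂_le fun i hi => ?_)
  · exact (hsim.measurable_number i ⟨hi.1, hi.2.trans_le hk⟩).comap_le
  · exact (hsim.measurable_leaf i ⟨hi.1, hi.2.trans hk⟩).comap_le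

theorem uniformMatch_congr_of_boundary {g g' : Game} {xs : Finset Word} {z v : Word}
    (hg' : g' ∈ consistent g (insert v xs)) (hv : v ∈ leaves g.tree) (hz : z ∈ g.tree)
    (hz' : z ∈ g'.tree) : uniformMatch g.tree z v = uniformMatch g'.tree z v := by
  by_cases hzv : z <+: v
  · exact (uniformMatch_eq_of_mem_matchEvent hzv hv
      (mem_matchEvent_of_mem_consistent (Finset.mem_insert_self _ _) hg' z)).symm
  · rw [not_not.1 (mt (uniformMatch_support g.isTree hz) fun h => hzv h.2),
      not_not.1 (mt (uniformMatch_support g'.isTree hz') fun h => hzv h.2)]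

/-- The transition probabilities of the algorithm: knowing that the game is `g` and that the visited
leaves are `xs`, the next match starts at `z` and leads to `v`. -/
def matchTransition (F : SelectionRule) (g : Game) (xs : Finset Word) (a : Word × Word) : ENNReal :=
  volume {u | F.select (observe g xs) u = a.1} *
    if a.1 ∈ xs then (if a.2 = a.1 then 1 else 0)
    else if a.1 ∈ boundary g.tree xs then uniformMatch g.tree a.1 a.2 else 0

theorem IsSimulation.measure_transition [IsProbabilityMeasure P]
    (hsim : IsSimulation P game F X x n) {k : ℕ} (hk : k ∈ Set.Ico 1 n) {g : Game}
    {xs : Finset Word} (hxs : xs ⊆ leaves g.tree) (hne : xs.Nonempty) (a : Word × Word) :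
    P ({ω | game ω = g ∧ visited x k ω = xs}
        ∩ (fun ω => (selected game F X x k ω, x (k + 1) ω)) ⁻¹' {a})
      = P {ω | game ω = g ∧ visited x k ω = xs} * matchTransition F g xs a := by
  obtain ⟨z, v⟩ := a
  have hpast := hsim.past_le hk.2.le
  have hS : MeasurableSet {u | F.select (observe g xs) u = z} :=
    F.measurable_select _ (measurableSet_singleton z)
  set B : Set Ω := {ω | game ω = g ∧ visited x k ω = xs}
    ∩ X k ⁻¹' {u | F.select (observe g xs) u = z} with hB
  have hBsel : ∀ ω, ω ∈ B ↔
      (game ω = g ∧ visited x k ω = xs) ∧ selected game F X x k ω = z := by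
    intro ω
    simp only [hB, Set.mem_inter_iff, Set.mem_ofPred_eq, Set.mem_preimage, selected]
    refine and_congr_right ?_
    rintro ⟨h1, h2⟩
    rw [h1, h2]
  have hBm : MeasurableSet[past game X x k ⊔ MeasurableSpace.comap (X k) inferInstance] B :=
    MeasurableSet.inter
      ((le_sup_left : past game X x k ≤ _) _ (measurableSet_game_visited_past k g xs))
      ((le_sup_right : MeasurableSpace.comap (X k) inferInstance ≤ _) _ ⟨_, hS, rfl⟩)
  have hPB : P B = P {ω | game ω = g ∧ visited x k ω = xs}
      * volume {u | F.select (observe g xs) u = z} := by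
    have h := (Indep_iff _ _ _).1 (hsim.indep_number k hk) _ _ ⟨_, hS, rfl⟩
      (measurableSet_game_visited_past k g xs)
    rw [hB, Set.inter_comm, h, mul_comm, ← hsim.uniform_number k hk,
      Measure.map_apply (hsim.measurable_number k hk) hS]
  have hset : {ω | game ω = g ∧ visited x k ω = xs}
        ∩ (fun ω => (selected game F X x k ω, x (k + 1) ω)) ⁻¹' {(z, v)}
      = B ∩ x (k + 1) ⁻¹' {v} := by
    ext ω
    rw [Set.mem_inter_iff, Set.mem_inter_iff, hBsel]
    simp only [Set.mem_ofPred_eq, Set.mem_preimage, Set.mem_singleton_iff, Prod.mk.injEq]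
    tauto
  rw [hset, matchTransition, ← mul_assoc, ← hPB]
  dsimp only
  split_ifs with hz hv hz'
  · rw [mul_one]
    refine measure_congr ?_
    filter_upwards [hsim.old_leaf k hk] with ω hω
    refine propext ⟨fun h => h.1, fun h => ⟨h, ?_⟩⟩
    obtain ⟨⟨h1, h2⟩, h3⟩ := (hBsel ω).1 h
    rw [h3, h2] at hω
    exact (hω hz).trans hv.symm
  · rw [mul_zero]
    refine measure_eq_zero_iff_ae_notMem.2 ?_
    filter_upwards [hsim.old_leaf k hk] with ω hω
    rintro ⟨h, hv'⟩
    obtain ⟨⟨h1, h2⟩, h3⟩ := (hBsel ω).1 h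
    rw [h3, h2] at hω
    exact hv (hv'.symm.trans (hω hz))
  · refine (hsim.new_match k hk).measure_inter
      (sup_le hpast (hsim.measurable_number k hk).comap_le)
      (hsim.measurable_leaf (k + 1) ⟨by omega, hk.2⟩) hBm (fun ω h => ?_) (fun ω h => ?_) v
    · obtain ⟨⟨h1, h2⟩, h3⟩ := (hBsel ω).1 h
      change selected game F X x k ω ∈ boundary (game ω).tree (visited x k ω)
      rwa [h3, h1, h2]
    · obtain ⟨⟨h1, h2⟩, h3⟩ := (hBsel ω).1 h
      exact ⟨h1, h3⟩
  · -- The selected node is visited or belongs to the boundary.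
    have : B = ∅ := by
      refine Set.eq_empty_of_forall_notMem fun ω h => ?_
      have h2 : F.select (observe g xs) (X k ω) = z := h.2
      have := F.select_mem _ (observe_isPossible hxs hne) (X k ω)
      rw [h2, Finset.mem_union] at this
      exact this.elim hz hz'
    rw [this]
    simp

theorem matchTransition_congr {g g' : Game} {xs : Finset Word} {a : Word × Word}
    (hl : insert a.2 xs ⊆ leaves g.tree) (hg' : g' ∈ consistent g (insert a.2 xs)) :
    matchTransition F g xs a = matchTransition F g' xs a := by
  obtain ⟨hv, hxs⟩ := Finset.insert_subset_iff.1 hl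
  have hobs : observe g' xs = observe g xs :=
    ((mem_consistent_iff_observe hxs).1 (consistent_mono (Finset.subset_insert _ _) hg')).2
  have hbd : boundary g'.tree xs = boundary g.tree xs := congrArg Observation.bdry hobs
  rw [matchTransition, matchTransition, hobs, hbd]
  congr 1
  split_ifs with h1 h2 h3
  · rfl
  · rfl
  · exact uniformMatch_congr_of_boundary hg' hv (mem_boundary_iff.1 h3).1
      (mem_boundary_iff.1 (hbd ▸ h3)).1
  · rfl

/-- The set of leaves visited by an admissible algorithm is neutral. -/
theorem IsSimulation.neutral_visited [IsProbabilityMeasure P] (hsim : IsSimulation P game F X x n)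
    {k : ℕ} (hk : k ≤ n) : Neutral P game (visited x k) := by
  induction k with
  | zero => exact neutral_empty hsim.measurable_game
  | succ k ih =>
    have ih := ih (by omega)
    have hmeas : Measurable (visited x (k + 1)) :=
      measurable_visited fun i hi => hsim.measurable_leaf i ⟨hi.1, hi.2.trans hk⟩
    have hx : Measurable (x (k + 1)) := hsim.measurable_leaf _ ⟨by omega, hk⟩
    rcases Nat.eq_zero_or_pos k with rfl | hpos
    · have hvis0 : ∀ ω, visited x 0 ω = ∅ := fun ω => rfl
      refine ih.step hsim.measurable_game hmeas hx (fun xs v => insert v xs)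
        (Filter.Eventually.of_forall fun ω => visited_succ x 0 ω)
        (fun g _ v => uniformMatch g.tree [] v) (fun g xs v => ?_) (fun g xs v h _ hv => ?_)
        (fun g g' xs v _ hl hg' => ?_)
      · by_cases e : ∅ = xs
        · refine hsim.first_match.measure_inter hsim.measurable_game.comap_le hx ?_
            (Set.subset_univ _) (fun ω hω => ⟨hω.1, rfl⟩) v
          refine ⟨{g}, trivial, ?_⟩
          ext ω
          simp [hvis0, e]
        · simp [hvis0, e]
      · obtain rfl : ∅ = xs := by
          by_contra e
          simp [hvis0, e] at h
        refine ⟨Finset.empty_subset _, ?_⟩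
        simpa using (uniformMatch_support g.isTree g.isTree.root_mem hv).1
      · exact uniformMatch_congr_of_boundary hg' (hl (Finset.mem_insert_self _ _))
          g.isTree.root_mem g'.isTree.root_mem
    · have hkn : k ∈ Set.Ico 1 n := ⟨hpos, hk⟩
      have hsel : Measurable (selected game F X x k) := by
        -- The selected node is a function of the countably valued observation and of `X k`.
        have h1 : Measurable fun ω => observe (game ω) (visited x k ω) :=
          (Measurable.of_discrete (f := fun q : Game × Finset Word => observe q.1 q.2)).comp
            (hsim.measurable_game.prodMk ih.measurable_vis)
        exact (measurable_from_prod_countable_right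
          (f := fun q : Observation × unitInterval => F.select q.1 q.2) F.measurable_select).comp
          (h1.prodMk (hsim.measurable_number k hkn))
      have hnonempty : ∀ g xs, P {ω | game ω = g ∧ visited x k ω = xs} ≠ 0 → xs.Nonempty := by
        intro g xs h
        obtain ⟨ω, hω⟩ := nonempty_of_measure_ne_zero h
        exact ⟨x 1 ω, hω.2 ▸ Finset.mem_image_of_mem _ (Finset.mem_Icc.2 ⟨le_rfl, hpos⟩)⟩
      refine ih.step hsim.measurable_game hmeas (hsel.prodMk hx) (fun xs a => insert a.2 xs)
        (Filter.Eventually.of_forall fun ω => visited_succ x k ω)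
        (matchTransition F) (fun g xs a => ?_) (fun g xs a _ hxs ha => ?_)
        (fun g g' xs a _ hl hg' => matchTransition_congr hl hg')
      · by_cases h : P {ω | game ω = g ∧ visited x k ω = xs} = 0
        · rw [h, zero_mul]
          exact measure_mono_null Set.inter_subset_left h
        · exact hsim.measure_transition hkn (ih.subset_leaves g xs h) (hnonempty g xs h) a
      · refine ⟨Finset.subset_insert _ _, Finset.insert_subset ?_ hxs⟩
        have ha := right_ne_zero_of_mul ha
        split_ifs at ha with h1 h2 h3
        · exact h2 ▸ hxs h1
        · exact absurd rfl ha
        · exact (uniformMatch_support g.isTree (mem_boundary_iff.1 h3).1 ha).1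
        · exact absurd rfl ha

end Simulation

/-- The resulting leaf of the match started at `z`, if `z` is in the boundary. -/
def matchOutcome (game : Ω → Game) (vis : Ω → Finset Word) (z : Word) (y : Ω → Word) (ω : Ω) :
    Option Word :=
  if z ∈ bdry game vis ω then some (y ω) else none

/-- The visited leaves after the match with outcome `a`. -/
def insertOutcome (xs : Finset Word) (a : Option Word) : Finset Word :=
  a.elim xs fun v => insert v xs

/-- The law of `matchOutcome`, knowing that the game is `g` and that the visited leaves are `xs`. -/
def outcomeTransition (z : Word) (g : Game) (xs : Finset Word) (a : Option Word) : ENNReal :=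
  if z ∈ boundary g.tree xs then a.elim 0 fun v => uniformMatch g.tree z v
  else a.elim 1 fun _ => 0

theorem measure_matchOutcome [IsFiniteMeasure P] {vis : Ω → Finset Word} (h𝓗 : 𝓗 ≤ mΩ)
    (hgame𝓗 : Measurable[𝓗] game) (hvis𝓗 : Measurable[𝓗] vis)
    {z : Word} {y : Ω → Word} (hy : Measurable y)
    (hmatch : IsUniformMatchOn P game 𝓗 {ω | z ∈ bdry game vis ω} (fun _ => z) y)
    (g : Game) (xs : Finset Word) (a : Option Word) :
    P ({ω | game ω = g ∧ vis ω = xs} ∩ matchOutcome game vis z y ⁻¹' {a})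
      = P {ω | game ω = g ∧ vis ω = xs} * outcomeTransition z g xs a := by
  have hbd : ∀ ω ∈ {ω | game ω = g ∧ vis ω = xs},
      (z ∈ bdry game vis ω ↔ z ∈ boundary g.tree xs) := by
    rintro ω ⟨h1, h2⟩
    rw [bdry, h1, h2]
  unfold outcomeTransition
  split_ifs with hz
  · have hout : ∀ ω ∈ {ω | game ω = g ∧ vis ω = xs},
        matchOutcome game vis z y ω = some (y ω) := fun ω hω => if_pos ((hbd ω hω).2 hz)
    cases a with
    | none =>
      have : {ω | game ω = g ∧ vis ω = xs} ∩ matchOutcome game vis z y ⁻¹' {none} = ∅ := by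
        refine Set.eq_empty_of_forall_notMem fun ω hω => ?_
        exact Option.some_ne_none _ ((hout ω hω.1).symm.trans hω.2)
      rw [this, measure_empty, Option.elim_none, mul_zero]
    | some v =>
      have : {ω | game ω = g ∧ vis ω = xs} ∩ matchOutcome game vis z y ⁻¹' {some v}
          = {ω | game ω = g ∧ vis ω = xs} ∩ y ⁻¹' {v} := by
        ext ω
        rw [Set.mem_inter_iff, Set.mem_inter_iff]
        refine and_congr_right fun hω => ?_
        rw [Set.mem_preimage, hout ω hω]
        exact Option.some_inj
      rw [this]
      exact hmatch.measure_inter h𝓗 hy (MeasurableSet.inter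
        (hgame𝓗 (measurableSet_singleton g)) (hvis𝓗 (measurableSet_singleton xs)))
        (fun ω hω => (hbd ω hω).2 hz) (fun ω hω => ⟨hω.1, rfl⟩) v
  · have hout : ∀ ω ∈ {ω | game ω = g ∧ vis ω = xs},
        matchOutcome game vis z y ω = none := fun ω hω => if_neg fun h => hz ((hbd ω hω).1 h)
    cases a with
    | none =>
      have : {ω | game ω = g ∧ vis ω = xs} ∩ matchOutcome game vis z y ⁻¹' {none}
          = {ω | game ω = g ∧ vis ω = xs} :=
        Set.inter_eq_left.2 hout
      rw [this, Option.elim_none, mul_one]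
    | some v =>
      have : {ω | game ω = g ∧ vis ω = xs} ∩ matchOutcome game vis z y ⁻¹' {some v} = ∅ := by
        refine Set.eq_empty_of_forall_notMem fun ω hω => ?_
        exact Option.some_ne_none v (hω.2.symm.trans (hout ω hω.1))
      rw [this, measure_empty, Option.elim_some, mul_zero]

theorem outcomeTransition_congr {z : Word} {g g' : Game} {xs : Finset Word} {a : Option Word}
    (hsub : xs ⊆ insertOutcome xs a) (hl : insertOutcome xs a ⊆ leaves g.tree)
    (hg' : g' ∈ consistent g (insertOutcome xs a)) :
    outcomeTransition z g xs a = outcomeTransition z g' xs a := by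
  have hbd : boundary g'.tree xs = boundary g.tree xs :=
    congrArg Observation.bdry ((mem_consistent_iff_observe (hsub.trans hl)).1
      (consistent_mono hsub hg')).2
  rw [outcomeTransition, outcomeTransition, hbd]
  cases a with
  | none => rfl
  | some v =>
    split_ifs with hz
    · exact uniformMatch_congr_of_boundary hg' (hl (Finset.mem_insert_self _ _))
        (mem_boundary_iff.1 hz).1 (mem_boundary_iff.1 (hbd ▸ hz)).1
    · rfl

/-- Neutrality is preserved by one more uniformly random match from a fixed node of the boundary. -/
theorem Neutral.neutral_addMatch [IsProbabilityMeasure P] (hgame : Measurable game)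
    {vis : Ω → Finset Word} (hvis : Neutral P game vis) (h𝓗 : 𝓗 ≤ mΩ)
    (hgame𝓗 : Measurable[𝓗] game) (hvis𝓗 : Measurable[𝓗] vis)
    {z : Word} {y : Ω → Word} (hy : Measurable y)
    (hmatch : IsUniformMatchOn P game 𝓗 {ω | z ∈ bdry game vis ω} (fun _ => z) y) :
    Neutral P game (addMatch game vis z y) := by
  have hpair : Measurable fun ω => (game ω, vis ω, y ω) :=
    hgame.prodMk (hvis.measurable_vis.prodMk hy)
  let : MeasurableSpace (Option Word) := ⊤
  have : DiscreteMeasurableSpace (Option Word) := ⟨fun _ => trivial⟩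
  have hAe : matchOutcome game vis z y = (fun q : Game × Finset Word × Word =>
      if z ∈ boundary q.1.tree q.2.1 then some q.2.2 else none)
        ∘ fun ω => (game ω, vis ω, y ω) := by
    funext ω
    rw [matchOutcome, bdry, Function.comp_apply]
  have hA : Measurable (matchOutcome game vis z y) := by
    rw [hAe]
    exact Measurable.of_discrete.comp hpair
  have hme : addMatch game vis z y = (fun q : Game × Finset Word × Word =>
      if z ∈ boundary q.1.tree q.2.1 then insert q.2.2 q.2.1 else q.2.1)
        ∘ fun ω => (game ω, vis ω, y ω) := by
    funext ω
    rw [addMatch, bdry, Function.comp_apply]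
  have hm : Measurable (addMatch game vis z y) := by
    rw [hme]
    exact Measurable.of_discrete.comp hpair
  refine hvis.step hgame hm hA insertOutcome (Filter.Eventually.of_forall fun ω => ?_)
    (outcomeTransition z) (measure_matchOutcome h𝓗 hgame𝓗 hvis𝓗 hy hmatch)
    (fun g xs a _ hxs ha => ?_) (fun g g' xs a => outcomeTransition_congr)
  · rw [addMatch, matchOutcome]
    split_ifs <;> rfl
  · cases a with
    | none => exact ⟨subset_rfl, hxs⟩
    | some v =>
      unfold outcomeTransition at ha
      split_ifs at ha with hz
      · exact ⟨Finset.subset_insert _ _, Finset.insert_subset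
          (uniformMatch_support g.isTree (mem_boundary_iff.1 hz).1 ha).1 hxs⟩
      · exact absurd rfl ha

section Posterior

variable {vis : Ω → Finset Word}

theorem measurable_observe (hgame : Measurable game) (hvis : Measurable vis) :
    Measurable fun ω => observe (game ω) (vis ω) :=
  (Measurable.of_discrete (f := fun q : Game × Finset Word => observe q.1 q.2)).comp
    (hgame.prodMk hvis)

theorem measurableSet_sameObservation (hgame : Measurable game) (hvis : Measurable vis) (ω₀ : Ω) :
    MeasurableSet (sameObservation game vis ω₀) :=
  measurable_observe hgame hvis (measurableSet_singleton _)

theorem measure_sameObservation_ne_zero {ω₀ : Ω}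
    (hω₀ : P {ω | game ω = game ω₀ ∧ vis ω = vis ω₀} ≠ 0) :
    P (sameObservation game vis ω₀) ≠ 0 := by
  refine fun h => hω₀ (measure_mono_null ?_ h)
  rintro ω ⟨h1, h2⟩
  simp [sameObservation, h1, h2]

theorem map_game_singleton_ne_zero (hgame : Measurable game) {ω₀ : Ω}
    (hω₀ : P {ω | game ω = game ω₀ ∧ vis ω = vis ω₀} ≠ 0) :
    P.map game {game ω₀} ≠ 0 := by
  rw [Measure.map_apply hgame (measurableSet_singleton _)]
  exact fun h => hω₀ (measure_mono_null (fun ω hω => hω.1) h)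

theorem map_consistent_ne_zero (hgame : Measurable game) (hvis : Neutral P game vis) {ω₀ : Ω}
    (hω₀ : P {ω | game ω = game ω₀ ∧ vis ω = vis ω₀} ≠ 0) :
    P.map game (consistent (game ω₀) (vis ω₀)) ≠ 0 := by
  refine fun h => map_game_singleton_ne_zero hgame hω₀ (measure_mono_null ?_ h)
  simpa using self_mem_consistent (hvis.subset_leaves _ _ hω₀)

/-- Knowing the observation, the law of the game is the law of the game conditioned to be consistent
with the observation. -/
theorem Neutral.map_cond [IsProbabilityMeasure P] (hgame : Measurable game)
    (hvis : Neutral P game vis) {ω₀ : Ω}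
    (hω₀ : P {ω | game ω = game ω₀ ∧ vis ω = vis ω₀} ≠ 0) :
    (P[|sameObservation game vis ω₀]).map game
      = (P.map game)[|consistent (game ω₀) (vis ω₀)] := by
  have hxs := hvis.subset_leaves _ _ hω₀
  have hμ₀ := map_game_singleton_ne_zero hgame hω₀
  have hprob : IsProbabilityMeasure (P.map game) := Measure.isProbabilityMeasure_map hgame.aemeasurable
  have hO := measurableSet_sameObservation hgame hvis.measurable_vis ω₀
  -- The likelihood of the observation, for all the games which are consistent with it.
  set κ : ENNReal := P {ω | game ω = game ω₀ ∧ vis ω = vis ω₀} / P.map game {game ω₀} with hκ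
  have hκ0 : κ ≠ 0 := ENNReal.div_ne_zero.2 ⟨hω₀, measure_ne_top _ _⟩
  have hκt : κ ≠ ⊤ := ENNReal.div_ne_top (measure_ne_top _ _) hμ₀
  have hrestrict : (P.restrict (sameObservation game vis ω₀)).map game
      = κ • (P.map game).restrict (consistent (game ω₀) (vis ω₀)) := by
    refine Measure.ext_of_singleton fun g => ?_
    rw [Measure.map_apply hgame (measurableSet_singleton _),
      Measure.restrict_apply (hgame (measurableSet_singleton _)), Measure.smul_apply, smul_eq_mul,
      Measure.restrict_apply (measurableSet_singleton _)]
    by_cases hg : g ∈ consistent (game ω₀) (vis ω₀)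
    · have h1 : game ⁻¹' {g} ∩ sameObservation game vis ω₀
          = {ω | game ω = g ∧ vis ω = vis ω₀} := by
        ext ω
        constructor
        · exact fun h => ⟨h.1, vis_eq_of_mem_sameObservation h.2⟩
        · rintro ⟨h1, h2⟩
          refine ⟨h1, ?_⟩
          simp only [sameObservation, Set.mem_preimage, Set.mem_singleton_iff, h1, h2]
          exact ((mem_consistent_iff_observe hxs).1 hg).2
      have h2 : {g} ∩ consistent (game ω₀) (vis ω₀) = {g} := by simpa using hg
      have h := hvis.likelihood _ g _ hxs hg
      rw [h1, h2, hκ, ENNReal.div_eq_inv_mul, mul_assoc, mul_comm (P _), h, ← mul_assoc,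
        ENNReal.inv_mul_cancel hμ₀ (measure_ne_top _ _), one_mul]
    · have h2 : {g} ∩ consistent (game ω₀) (vis ω₀) = ∅ := by simpa using hg
      rw [h2, measure_empty, mul_zero]
      by_contra hne
      refine hg ?_
      obtain ⟨ω, hω1, hω2⟩ := nonempty_of_measure_ne_zero hne
      have hpos : P {ω | game ω = g ∧ vis ω = vis ω₀} ≠ 0 := fun h => hne (measure_mono_null
        (fun ω h => (⟨h.1, vis_eq_of_mem_sameObservation h.2⟩ : game ω = g ∧ vis ω = vis ω₀)) h)
      refine (mem_consistent_iff_observe hxs).2 ⟨hvis.subset_leaves _ _ hpos, ?_⟩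
      have e : observe (game ω) (vis ω) = observe (game ω₀) (vis ω₀) := hω2
      rwa [vis_eq_of_mem_sameObservation hω2, show game ω = g from hω1] at e
  have htot : P (sameObservation game vis ω₀)
      = κ * P.map game (consistent (game ω₀) (vis ω₀)) := by
    have := congrArg (fun ν : Measure Game => ν Set.univ) hrestrict
    simpa [Measure.map_apply hgame MeasurableSet.univ] using this
  rw [ProbabilityTheory.cond, ProbabilityTheory.cond, Measure.map_smul, hrestrict, htot, smul_smul]
  congr 1
  rw [ENNReal.mul_inv (Or.inl hκ0) (Or.inl hκt), mul_comm κ⁻¹, mul_assoc,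
    ENNReal.inv_mul_cancel hκ0 hκt, mul_one]

theorem Neutral.condValue_eq [IsProbabilityMeasure P] (hgame : Measurable game)
    (hvis : Neutral P game vis) {ω₀ : Ω}
    (hω₀ : P {ω | game ω = game ω₀ ∧ vis ω = vis ω₀} ≠ 0) (u : Word) :
    condValue P game vis u ω₀ = winProb (P.map game) (consistent (game ω₀) (vis ω₀)) u := by
  rw [winProb, ← hvis.map_cond hgame hω₀, map_measureReal_apply hgame MeasurableSet.of_discrete]
  exact condExp_indicator_comap_apply P (measurable_observe hgame hvis.measurable_vis)
    (hgame (MeasurableSet.of_discrete (s := {g : Game | g.value u = 1})))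
    (measure_sameObservation_ne_zero hω₀)

theorem ae_game_vis_ne_zero (P : Measure Ω) (game : Ω → Game) (vis : Ω → Finset Word) :
    ∀ᵐ ω₀ ∂P, P {ω | game ω = game ω₀ ∧ vis ω = vis ω₀} ≠ 0 := by
  filter_upwards [ae_preimage_singleton_ne_zero P (fun ω => (game ω, vis ω))] with ω₀ h
  simpa [Set.preimage] using h

/-- Knowing the observation, the joint law of the game and of the leaf resulting from a match
started at the node `z` of the boundary. -/
theorem Neutral.map_cond_match [IsProbabilityMeasure P] (hgame : Measurable game)
    (hvis : Neutral P game vis)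
    (h𝓗 : 𝓗 ≤ mΩ) (hgame𝓗 : Measurable[𝓗] game) (hvis𝓗 : Measurable[𝓗] vis)
    {z : Word} {y : Ω → Word} (hy : Measurable y)
    (hmatch : IsUniformMatchOn P game 𝓗 {ω | z ∈ bdry game vis ω} (fun _ => z) y) {ω₀ : Ω}
    (hω₀ : P {ω | game ω = game ω₀ ∧ vis ω = vis ω₀} ≠ 0)
    (hz : z ∈ boundary (game ω₀).tree (vis ω₀)) :
    (P[|sameObservation game vis ω₀]).map (fun ω => (game ω, y ω))
      = matchLaw (P.map game) (consistent (game ω₀) (vis ω₀)) z := by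
  have hprob : IsProbabilityMeasure (P.map game) := Measure.isProbabilityMeasure_map hgame.aemeasurable
  have hO := measurableSet_sameObservation hgame hvis.measurable_vis ω₀
  refine Measure.ext_of_singleton fun p => ?_
  rw [matchLaw, compProd_matchKernel_singleton, ← hvis.map_cond hgame hω₀,
    Measure.map_apply (hgame.prodMk hy) (measurableSet_singleton _),
    Measure.map_apply hgame (measurableSet_singleton _), cond_apply hO, cond_apply hO, mul_assoc]
  have hset : sameObservation game vis ω₀ ∩ (fun ω => (game ω, y ω)) ⁻¹' {p}
      = (sameObservation game vis ω₀ ∩ game ⁻¹' {p.1}) ∩ y ⁻¹' {p.2} := by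
    ext ω
    simp [Prod.ext_iff, and_assoc]
  rw [hset, hmatch.measure_inter h𝓗 hy (g := p.1) (z₀ := z) ?_ ?_ (fun ω hω => ⟨hω.2, rfl⟩)]
  · have : Measurable[𝓗] fun ω => observe (game ω) (vis ω) :=
      (Measurable.of_discrete (f := fun q : Game × Finset Word => observe q.1 q.2)).comp
        (hgame𝓗.prodMk hvis𝓗)
    exact MeasurableSet.inter (this (measurableSet_singleton _))
      (hgame𝓗 (measurableSet_singleton _))
  · rintro ω ⟨hω, -⟩
    have e : boundary (game ω).tree (vis ω) = boundary (game ω₀).tree (vis ω₀) :=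
      congrArg Observation.bdry hω
    change z ∈ boundary (game ω).tree (vis ω)
    rwa [e]

/-- The mean square error on the value of the root after one more match from `z`. -/
theorem Neutral.condSqError_eq [IsProbabilityMeasure P] (hb : BranchingProperty (P.map game))
    (hgame : Measurable game)
    (hvis : Neutral P game vis)
    (h𝓗 : 𝓗 ≤ mΩ) (hgame𝓗 : Measurable[𝓗] game) (hvis𝓗 : Measurable[𝓗] vis)
    {z : Word} {y : Ω → Word} (hy : Measurable y)
    (hmatch : IsUniformMatchOn P game 𝓗 {ω | z ∈ bdry game vis ω} (fun _ => z) y) {ω₀ : Ω}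
    (hω₀ : P {ω | game ω = game ω₀ ∧ vis ω = vis ω₀} ≠ 0)
    (hz : z ∈ boundary (game ω₀).tree (vis ω₀)) :
    condSqError P game vis z y ω₀
      = Var[({g | g.value [] = 1} : Set Game).indicator (fun _ => (1 : ℝ));
          (P.map game)[|consistent (game ω₀) (vis ω₀)]]
        - pathWeight (game ω₀).tree (winProb (P.map game) (consistent (game ω₀) (vis ω₀))) z ^ 2
          * meanInformation (P.map game) (kin (game ω₀).tree z) z := by
  have hprob : IsProbabilityMeasure (P.map game) := Measure.isProbabilityMeasure_map hgame.aemeasurable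
  have hvis' := hvis.neutral_addMatch hgame h𝓗 hgame𝓗 hvis𝓗 hy hmatch
  have hxs := hvis.subset_leaves _ _ hω₀
  have hzT := (mem_boundary_iff.1 hz).1
  have hzs := fun v => strictPrefix_of_mem_boundary (v := v) hz
  have hV : MeasurableSet {ω | (game ω).value [] = 1} :=
    hgame (MeasurableSet.of_discrete (s := {g : Game | g.value [] = 1}))
  have hval : (fun ω => (game ω).value [])
      = ({ω | (game ω).value [] = 1} : Set Ω).indicator (fun _ => (1 : ℝ)) := by
    funext ω
    simp only [Game.value, Set.indicator_apply, Set.mem_ofPred_eq]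
    split_ifs <;> simp_all
  have hL : MemLp (({ω | (game ω).value [] = 1} : Set Ω).indicator fun _ => (1 : ℝ)) 2 P :=
    memLp_indicator_const 2 hV 1 (Or.inr (measure_ne_top _ _))
  have hint : Integrable (fun ω =>
      (condValue P game (addMatch game vis z y) [] ω - (game ω).value []) ^ 2) P := by
    have h1 : MemLp (condValue P game (addMatch game vis z y) []) 2 P :=
      hL.condExp one_le_two
    have h2 : MemLp (fun ω => (game ω).value []) 2 P := hval ▸ hL
    exact (h1.sub h2).integrable_sq
  rw [← integral_sq_error hb hxs hz (map_consistent_ne_zero hgame hvis hω₀),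
    ← hvis.map_cond_match hgame h𝓗 hgame𝓗 hvis𝓗 hy hmatch hω₀ hz,
    integral_map (hgame.prodMk hy).aemeasurable
      Measurable.of_discrete.aestronglyMeasurable,
    hvis.map_cond_match hgame h𝓗 hgame𝓗 hvis𝓗 hy hmatch hω₀ hz]
  refine (condExp_comap_apply P (measurable_observe hgame hvis.measurable_vis) hint
    (measure_sameObservation_ne_zero hω₀)).trans ?_
  change ∫ ω, _ ∂(P[|sameObservation game vis ω₀]) = _
  refine integral_congr_ae ?_
  have hac : P[|sameObservation game vis ω₀] ≪ P := cond_absolutelyContinuous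
  have hmap : ∀ᵐ ω ∂(P[|sameObservation game vis ω₀]),
      matchLaw (P.map game) (consistent (game ω₀) (vis ω₀)) z {(game ω, y ω)} ≠ 0 := by
    rw [← hvis.map_cond_match hgame h𝓗 hgame𝓗 hvis𝓗 hy hmatch hω₀ hz]
    exact ae_of_ae_map (hgame.prodMk hy).aemeasurable (ae_singleton_ne_zero _)
  filter_upwards [hac.ae_le (ae_game_vis_ne_zero P game (addMatch game vis z y)), hmap,
    ae_cond_mem (μ := P) (measurableSet_sameObservation hgame hvis.measurable_vis ω₀)]
    with ω h1 h2 h3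
  have hE : ∀ g ∈ consistent (game ω₀) (vis ω₀), z ∈ g.tree := fun g hg =>
    (consistent_subset_explored hzT hzs hg).1
  obtain ⟨h4, -, -, h5⟩ := matchLaw_support hE h2
  have hbd : z ∈ bdry game vis ω := by
    have e : boundary (game ω).tree (vis ω) = boundary (game ω₀).tree (vis ω₀) :=
      congrArg Observation.bdry h3
    rwa [bdry, e]
  rw [hvis'.condValue_eq hgame h1, (matchPosterior_apply hE [] h2).2,
    consistent_inter_matchEvent hzs h4 h5, addMatch, if_pos hbd,
    vis_eq_of_mem_sameObservation h3, congrFun hval ω]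
  rfl

end Posterior

end Matches

/-! ### The descent -/

/-- The nodes revealed by the visited leaves `xs`: those of the branches from the root to the
visited leaves, and of their boundary. -/
def IsRevealed (T xs : Finset Word) (u : Word) : Prop :=
  u ∈ T ∧ ∀ v, StrictPrefix v u → ∃ x ∈ xs, StrictPrefix v x

theorem isRevealed_nil {T xs : Finset Word} (hT : IsTree T) : IsRevealed T xs [] :=
  ⟨hT.root_mem, fun v hv => absurd hv.length_lt (by simp)⟩

theorem isRevealed_of_mem_boundary {T xs : Finset Word} {z : Word} (hz : z ∈ boundary T xs) :
    IsRevealed T xs z :=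
  ⟨(mem_boundary_iff.1 hz).1, fun _ => strictPrefix_of_mem_boundary hz⟩

theorem IsRevealed.of_prefix {T xs : Finset Word} {u z : Word} (hT : IsTree T)
    (hz : IsRevealed T xs z) (h : u <+: z) : IsRevealed T xs u :=
  ⟨hT.mem_of_prefix hz.1 h, fun v hv => hz.2 v (hv.trans_prefix h)⟩

theorem IsRevealed.exists_strictPrefix {T xs : Finset Word} {u : Word} (hne : xs.Nonempty)
    (hu : IsRevealed T xs u) (hx : u ∉ xs) (hb : u ∉ boundary T xs) :
    ∃ x ∈ xs, StrictPrefix u x := by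
  have key : ∃ x ∈ xs, u <+: x := by
    rcases List.eq_nil_or_concat u with rfl | ⟨v, k, rfl⟩
    · obtain ⟨x, hx⟩ := hne
      exact ⟨x, hx, List.nil_prefix⟩
    · rw [List.concat_eq_append] at *
      by_contra! h
      exact hb (mem_boundary_iff.2
        ⟨hu.1, ⟨v, k, rfl, hu.2 v (strictPrefix_snoc_iff.2 List.prefix_rfl)⟩, h⟩)
  obtain ⟨x, hx', hux⟩ := key
  exact ⟨x, hx', hux, fun e => hx (e ▸ hx')⟩

theorem isRevealed_of_mem_children {T xs : Finset Word} {u c : Word}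
    (h : ∃ x ∈ xs, StrictPrefix u x) (hc : c ∈ children T u) : IsRevealed T xs c := by
  obtain ⟨hcT, j, rfl⟩ := mem_children.1 hc
  obtain ⟨x, hx, hux⟩ := h
  exact ⟨hcT, fun v hv => ⟨x, hx, StrictPrefix.prefix_trans (strictPrefix_snoc_iff.1 hv) hux⟩⟩

theorem children_nonempty_of_strictPrefix {T : Finset Word} (hT : IsTree T) {u x : Word}
    (hx : x ∈ T) (h : StrictPrefix u x) : (children T u).Nonempty := by
  obtain ⟨k, hk⟩ := strictPrefix_iff.1 h
  exact ⟨u ++ [k], snoc_mem_children.2 (hT.mem_of_prefix hx hk)⟩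

theorem scoreZ_interior {μ : Measure Game} {T xs : Finset Word} {ρ : Word → ℝ} {u : Word}
    (hx : u ∉ xs) (hb : u ∉ boundary T xs) (hne : (children T u).Nonempty) :
    scoreZ μ T xs ρ u = (children T u).sup' hne
      fun y => weightU T ρ y ^ 2 * scoreZ μ T xs ρ y := by
  have hne' : (children T u).attach.Nonempty := by simpa using hne
  rw [scoreZ, if_neg hx, if_neg hb, dif_pos hne']
  refine le_antisymm (Finset.sup'_le _ _ fun y _ => ?_) (Finset.sup'_le _ _ fun y hy => ?_)
  · exact Finset.le_sup' (fun y => weightU T ρ y ^ 2 * scoreZ μ T xs ρ y) y.2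
  · exact Finset.le_sup' (fun y : {y // y ∈ children T u} =>
      weightU T ρ y.1 ^ 2 * scoreZ μ T xs ρ y.1) (Finset.mem_attach _ ⟨y, hy⟩)

theorem scoreZ_of_mem_boundary {μ : Measure Game} {T xs : Finset Word} {ρ : Word → ℝ} {z : Word}
    (hz : z ∈ boundary T xs) : scoreZ μ T xs ρ z = meanInformation μ (kin T z) z := by
  rw [scoreZ, if_neg fun h => (mem_boundary_iff.1 hz).2.2 z h List.prefix_rfl, if_pos hz]

theorem meanInformation_nonneg (μ : Measure Game) (T : Finset Word) (z : Word) :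
    0 ≤ meanInformation μ T z :=
  integral_nonneg fun _ => sq_nonneg _

/-- Along a descent, the score of the root is the score of the current node, multiplied by the
square of the product of the weights along the branch. -/
theorem pathWeight_mul_scoreZ_of_descent {μ : Measure Game} {T xs : Finset Word} {ρ : Word → ℝ}
    {z : Word} (h : Relation.ReflTransGen (DescentStep μ T xs ρ) [] z) :
    pathWeight T ρ z ^ 2 * scoreZ μ T xs ρ z = scoreZ μ T xs ρ [] := by
  induction h with
  | refl => rw [pathWeight_nil, one_pow, one_mul]
  | @tail u c _ hstep ih =>
    obtain ⟨hx, hb, hc, hmax⟩ := hstep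
    have hu : scoreZ μ T xs ρ u = weightU T ρ c ^ 2 * scoreZ μ T xs ρ c := by
      rw [scoreZ_interior hx hb ⟨c, hc⟩]
      exact le_antisymm (Finset.sup'_le _ _ hmax)
        (Finset.le_sup' (fun y => weightU T ρ y ^ 2 * scoreZ μ T xs ρ y) hc)
    obtain ⟨-, j, rfl⟩ := mem_children.1 hc
    rw [← ih, hu, pathWeight_snoc]
    ring

/-- The score of the root is maximal. -/
theorem pathWeight_mul_scoreZ_le {μ : Measure Game} {T xs : Finset Word} {ρ : Word → ℝ}
    (hT : IsTree T) (hxs : xs ⊆ leaves T) {z : Word} (hz : IsRevealed T xs z) :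
    pathWeight T ρ z ^ 2 * scoreZ μ T xs ρ z ≤ scoreZ μ T xs ρ [] := by
  induction z using List.reverseRecOn with
  | nil => rw [pathWeight_nil, one_pow, one_mul]
  | append_singleton u k ih =>
    refine le_trans ?_ (ih (hz.of_prefix hT (List.prefix_append _ _)))
    obtain ⟨x, hx, hux⟩ := hz.2 u (strictPrefix_snoc_iff.2 List.prefix_rfl)
    have hc : u ++ [k] ∈ children T u := snoc_mem_children.2 hz.1
    have hu₁ : u ∉ xs := fun h => (mem_leaves.1 (hxs h)).2 x (mem_of_mem_leaves (hxs hx)) hux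
    have hu₂ : u ∉ boundary T xs := fun h => (mem_boundary_iff.1 h).2.2 x hx hux.1
    rw [scoreZ_interior hu₁ hu₂ ⟨_, hc⟩, pathWeight_snoc, mul_pow, mul_assoc]
    exact mul_le_mul_of_nonneg_left
      (Finset.le_sup' (fun y => weightU T ρ y ^ 2 * scoreZ μ T xs ρ y) hc) (sq_nonneg _)

theorem exists_descent {μ : Measure Game} {T xs : Finset Word} {ρ : Word → ℝ}
    (hT : IsTree T) (hxs : xs ⊆ leaves T) (hne : xs.Nonempty) {u : Word}
    (hu : IsRevealed T xs u) :
    ∃ z, Relation.ReflTransGen (DescentStep μ T xs ρ) u z ∧ z ∈ boundary T xs ∪ xs := by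
  induction hn : T.sup List.length + 1 - u.length using Nat.strong_induction_on generalizing u with
  | _ n ih =>
    by_cases hx : u ∈ xs
    · exact ⟨u, .refl, Finset.mem_union_right _ hx⟩
    by_cases hb : u ∈ boundary T xs
    · exact ⟨u, .refl, Finset.mem_union_left _ hb⟩
    have hex := hu.exists_strictPrefix hne hx hb
    obtain ⟨x, hx', hux⟩ := hex
    obtain ⟨c, hc, hmax⟩ := Finset.exists_max_image (children T u)
      (fun y => weightU T ρ y ^ 2 * scoreZ μ T xs ρ y)
      (children_nonempty_of_strictPrefix hT (mem_of_mem_leaves (hxs hx')) hux)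
    obtain ⟨z, hz, hz'⟩ := ih _ (hn ▸ length_lt_of_mem_children hc)
      (isRevealed_of_mem_children ⟨x, hx', hux⟩ hc) rfl
    exact ⟨z, .head ⟨hx, hb, hc, hmax⟩ hz, hz'⟩

/-- If the value of the root is not known, it depends on the value, not known either, of some node
of the boundary. -/
theorem exists_boundary_uncertain {μ : Measure Game} [IsProbabilityMeasure μ]
    (hb : BranchingProperty μ) {g₀ : Game} {xs : Finset Word} (h₀ : xs ⊆ leaves g₀.tree)
    (hne : xs.Nonempty) (hpos : μ (consistent g₀ xs) ≠ 0) {u : Word}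
    (hu : IsRevealed g₀.tree xs u)
    (hw : pathWeight g₀.tree (winProb μ (consistent g₀ xs)) u ≠ 0)
    (hu0 : 0 < winProb μ (consistent g₀ xs) u) (hu1 : winProb μ (consistent g₀ xs) u < 1) :
    ∃ z ∈ boundary g₀.tree xs, pathWeight g₀.tree (winProb μ (consistent g₀ xs)) z ≠ 0 ∧
      0 < winProb μ (consistent g₀ xs) z ∧ winProb μ (consistent g₀ xs) z < 1 := by
  induction hn : g₀.tree.sup List.length + 1 - u.length using Nat.strong_induction_on
    generalizing u with
  | _ n ih =>
    by_cases hbd : u ∈ boundary g₀.tree xs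
    · exact ⟨u, hbd, hw, hu0, hu1⟩
    have hx : u ∉ xs := by
      intro hx
      rcases winProb_visited h₀ hx hpos with h | h <;> linarith
    obtain ⟨x, hx', hux⟩ := hu.exists_strictPrefix hne hx hbd
    obtain ⟨c₀, hc₀⟩ := children_nonempty_of_strictPrefix g₀.isTree
      (mem_of_mem_leaves (h₀ hx')) hux
    have hr := fun c (hc : c ∈ children g₀.tree u) =>
      isRevealed_of_mem_children ⟨x, hx', hux⟩ hc
    have hr₀ := hr c₀ hc₀
    obtain ⟨hk, k, rfl⟩ := mem_children.1 hc₀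
    obtain ⟨c, hc, hwc, hc0, hc1⟩ := (indepAt_consistent hb h₀ hk hr₀.2 hpos).exists_child_uncertain
      hk hpos hu0 hu1
    have hlt := length_lt_of_mem_children hc
    have hrc := hr c hc
    obtain ⟨hj, j, rfl⟩ := mem_children.1 hc
    refine ih _ (hn ▸ hlt) hrc ?_ hc0 hc1 rfl
    rw [pathWeight_snoc]
    exact mul_ne_zero hw hwc

/-- When the value of the root is not known, the descents end at a node of the boundary, where
`pathWeight ^ 2 * meanInformation` is maximal. -/
theorem IsDescentEnd.maximal {μ : Measure Game} [IsProbabilityMeasure μ]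
    (hb : BranchingProperty μ) {g₀ : Game} {xs : Finset Word} (hg₀ : μ {g₀} ≠ 0)
    (h₀ : xs ⊆ leaves g₀.tree) (hne : xs.Nonempty)
    (hr0 : 0 < winProb μ (consistent g₀ xs) []) (hr1 : winProb μ (consistent g₀ xs) [] < 1)
    {z : Word} (hz : IsDescentEnd μ g₀.tree xs (winProb μ (consistent g₀ xs)) z) :
    z ∈ boundary g₀.tree xs ∧ ∀ z' ∈ boundary g₀.tree xs,
      pathWeight g₀.tree (winProb μ (consistent g₀ xs)) z' ^ 2
          * meanInformation μ (kin g₀.tree z') z'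
        ≤ pathWeight g₀.tree (winProb μ (consistent g₀ xs)) z ^ 2
          * meanInformation μ (kin g₀.tree z) z := by
  have hpos : μ (consistent g₀ xs) ≠ 0 := fun h =>
    hg₀ (measure_mono_null (by simpa using self_mem_consistent h₀) h)
  obtain ⟨hdesc, hend⟩ := hz
  have hscore := pathWeight_mul_scoreZ_of_descent hdesc
  have hle : ∀ z' ∈ boundary g₀.tree xs,
      pathWeight g₀.tree (winProb μ (consistent g₀ xs)) z' ^ 2
        * meanInformation μ (kin g₀.tree z') z'
      ≤ scoreZ μ g₀.tree xs (winProb μ (consistent g₀ xs)) [] := by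
    intro z' hz'
    rw [← scoreZ_of_mem_boundary (ρ := winProb μ (consistent g₀ xs)) hz']
    exact pathWeight_mul_scoreZ_le g₀.isTree h₀ (isRevealed_of_mem_boundary hz')
  rcases Finset.mem_union.1 hend with hzb | hzx
  · refine ⟨hzb, fun z' hz' => (hle z' hz').trans ?_⟩
    rw [← hscore, scoreZ_of_mem_boundary hzb]
  · -- At a visited leaf the score vanishes, whereas the score of the root is positive.
    exfalso
    have hzero : scoreZ μ g₀.tree xs (winProb μ (consistent g₀ xs)) z = 0 := by
      rw [scoreZ, if_pos hzx]
    obtain ⟨z', hz', hw, h0, h1⟩ := exists_boundary_uncertain hb h₀ hne hpos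
      (isRevealed_nil g₀.isTree) (by rw [pathWeight_nil]; exact one_ne_zero) hr0 hr1
    have heq : winProb μ (consistent g₀ xs) z' = winProb μ (explored g₀ z') z' := by
      rw [winProb, winProb, measureReal_def, measureReal_def,
        cond_consistent_apply hb h₀ hz' hpos (determinedAt_value z')]
    rw [heq] at h0 h1
    have hs : meanInformation μ (kin g₀.tree z') z' ≠ 0 := fun hs =>
      winProb_certain_of_meanInformation_eq_zero hb hg₀ (mem_boundary_iff.1 hz').1 hs ⟨h0, h1⟩
    have hs' := (meanInformation_nonneg μ (kin g₀.tree z') z').lt_of_ne' hs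
    have := hle z' hz'
    rw [← hscore, hzero, mul_zero] at this
    exact absurd this (not_le.2 (mul_pos (by positivity) hs'))

end

end MCTS

open MeasureTheory MCTS in
theorem theorem2p10 {Ω : Type*} [MeasurableSpace Ω] (P : Measure Ω) [IsProbabilityMeasure P]
    (game : Ω → Game) (hbranching : BranchingProperty (P.map game))
    (F : SelectionRule) (X : ℕ → Ω → unitInterval) (x : ℕ → Ω → Word)
    (n : ℕ) (hn : 1 ≤ n) (hsim : IsSimulation P game F X x n)
    (y : Word → Ω → Word) (hy_meas : ∀ z, Measurable (y z))
    (hy : ∀ z, IsUniformMatchOn P game (past game X x n)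
      {ω | z ∈ bdry game (visited x n) ω} (fun _ => z) (y z)) :
    ∀ᵐ ω ∂P, condValue P game (visited x n) [] ω ∉ ({0, 1} : Set ℝ) →
      (∃ z, IsDescentEnd (P.map game) (game ω).tree (visited x n ω)
        (fun u => condValue P game (visited x n) u ω) z) ∧
      ∀ z, IsDescentEnd (P.map game) (game ω).tree (visited x n ω)
          (fun u => condValue P game (visited x n) u ω) z →
        z ∈ bdry game (visited x n) ω ∧
        ∀ z' ∈ bdry game (visited x n) ω,
          condSqError P game (visited x n) z (y z) ω
            ≤ condSqError P game (visited x n) z' (y z') ω := by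
  have hgame := hsim.measurable_game
  have hvis := hsim.neutral_visited le_rfl
  have hprob : IsProbabilityMeasure (P.map game) :=
    Measure.isProbabilityMeasure_map hgame.aemeasurable
  filter_upwards [ae_game_vis_ne_zero P game (visited x n)] with ω hω hr
  have hxs := hvis.subset_leaves _ _ hω
  have hne : (visited x n ω).Nonempty :=
    ⟨x 1 ω, Finset.mem_image_of_mem _ (Finset.mem_Icc.2 ⟨le_rfl, hn⟩)⟩
  have hρ : (fun u => condValue P game (visited x n) u ω)
      = winProb (P.map game) (consistent (game ω) (visited x n ω)) :=
    funext fun u => hvis.condValue_eq hgame hω u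
  rw [hvis.condValue_eq hgame hω, Set.mem_insert_iff, Set.mem_singleton_iff, not_or] at hr
  have hr0 := (winProb_nonneg (P.map game) (consistent (game ω) (visited x n ω)) []).lt_of_ne'
    hr.1
  have hr1 := (winProb_le_one (μ := P.map game)
    (E := consistent (game ω) (visited x n ω)) []).lt_of_ne hr.2
  rw [hρ]
  refine ⟨exists_descent (game ω).isTree hxs hne (isRevealed_nil (game ω).isTree),
    fun z hz => ?_⟩
  obtain ⟨hzb, hmax⟩ := IsDescentEnd.maximal hbranching (map_game_singleton_ne_zero hgame hω)
    hxs hne hr0 hr1 hz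
  refine ⟨hzb, fun z' hz' => ?_⟩
  have herr := fun w (hw : w ∈ boundary (game ω).tree (visited x n ω)) =>
    hvis.condSqError_eq hbranching hgame (hsim.past_le le_rfl) (measurable_game_past n)
      (measurable_visited_past n) (hy_meas w) (hy w) hω hw
  rw [herr z hzb, herr z' hz']
  exact sub_le_sub_left (hmax z' hz') _
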